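/- For a positive integer $N$, let $\star$ be the binary operation on $\{1,\dots,N\}$ determined recursively (descending on $p$, ascending on $q$) by $p\star 1\equiv p+1 \pmod N$ and $p\star(q+1)=(p\star q)\star(p\star 1)$ for $1\le q<N$; when $N=2^n$ it is the Laver table of size $2^n$. For nonnegative integers $p,q$ put $p*q=N-(N-p)\star(N-q)$, where $N$ is a power of $2$ with $p,q<N$ (the value does not depend on the choice of $N$; for definiteness, take the smallest one). For $p\ge 1$ let $\pi(p)$ be the least positive period of the sequence $q\mapsto p*q$ $(q=0,1,2,\dots)$, and let $\mathrm{bit}(m)$ be the number of ones in the binary expansion of $m$. A positive integer $p$ is called maximal if $\pi(p)=2^{\mathrm{bit}(p-1)}$. Then the set of maximal elements consists of $p=1$ together with exactly those integers $p\ge 2$ such that the binary expansion of $p-1$ (most significant digit first) has the form $$1\,0^{b_0}\,1^{2^{a_1}}\,0^{b_1 2^{a_1}}\,1^{2^{a_2}}\,0^{b_2 2^{a_2}}\cdots 1^{2^{a_r}}\,0^{b_r 2^{a_r}}$$ for some integers $r\ge 0$, $0\le a_1<a_2<\dots<a_r$ and $b_0,b_1,\dots,b_r\ge 0$. -/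

import Mathlib

/-- The binary operation `p ⋆ q` on `{1, …, N}` determined by `p ⋆ 1 = p + 1 mod N` and
`p ⋆ (q + 1) = (p ⋆ q) ⋆ (p ⋆ 1)`, built by induction, descending on `p` and ascending on `q`.
The row `p = N` is `N ⋆ q = q`.  The values at `q = 0` and in the last `else` branch are
irrelevant: see `laverStar_bounds` and `laverStar_succ` below.  For `N = 2 ^ n` this is the
Laver table of size `2 ^ n`. -/
def laverStar (N p q : ℕ) : ℕ :=
  if p < N then
    match q with
    | 0 => 0
    | 1 => p + 1
    | k + 2 =>
      if p < laverStar N p (k + 1) then laverStar N (laverStar N p (k + 1)) (p + 1) else 0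
  else q
termination_by (N - p, q)
decreasing_by
  all_goals first
    | exact Prod.Lex.right _ (by omega)
    | exact Prod.Lex.left _ _ (by omega)

theorem laverStar_last (N q : ℕ) : laverStar N N q = q := by
  rw [laverStar.eq_def]; simp

theorem laverStar_one {N p : ℕ} (hp : p < N) : laverStar N p 1 = p + 1 := by
  rw [laverStar.eq_def]; simp [hp]

/-- For `p < N` all the entries of the row of `p` lie in `{p + 1, …, N}`. -/
theorem laverStar_bounds {N : ℕ} : ∀ {p q : ℕ}, p < N → 1 ≤ q →
    p < laverStar N p q ∧ laverStar N p q ≤ N := by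
  suffices H : ∀ d p q : ℕ, N - p = d → p < N → 1 ≤ q →
      p < laverStar N p q ∧ laverStar N p q ≤ N from
    fun {p q} hp hq => H _ p q rfl hp hq
  intro d
  induction d using Nat.strong_induction_on with
  | _ d ihd =>
    intro p q hd hp hq
    induction q, hq using Nat.le_induction with
    | base => rw [laverStar_one hp]; omega
    | succ q hq ih =>
      obtain ⟨k, rfl⟩ : ∃ k, q = k + 1 := ⟨q - 1, by omega⟩
      rw [laverStar.eq_def]
      simp only [hp, ih.1, if_true]
      rcases Nat.lt_or_ge (laverStar N p (k + 1)) N with h | h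
      · have := ihd (N - laverStar N p (k + 1)) (by omega) _ (p + 1) rfl h (by omega)
        omega
      · rw [show laverStar N p (k + 1) = N by omega, laverStar_last]; omega

/-- The defining recursion `p ⋆ (q + 1) = (p ⋆ q) ⋆ (p ⋆ 1)` of the operation. -/
theorem laverStar_succ {N p q : ℕ} (hp : p ≤ N) (hq : 1 ≤ q) (hqN : q < N) :
    laverStar N p (q + 1) = laverStar N (laverStar N p q) (laverStar N p 1) := by
  rcases Nat.lt_or_ge p N with h | h
  · obtain ⟨k, rfl⟩ : ∃ k, q = k + 1 := ⟨q - 1, by omega⟩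
    rw [laverStar_one h]
    conv_lhs => rw [laverStar.eq_def]
    simp [h, (laverStar_bounds h hq).1]
  · obtain rfl : p = N := by omega
    rw [laverStar_last, laverStar_last, laverStar_last, laverStar_one hqN]

/-- The operation `p * q = N - (N - p) ⋆ (N - q)` on the nonnegative integers, where `N` is the
smallest power of two with `p, q < N`. -/
def laverMul (p q : ℕ) : ℕ :=
  2 ^ Nat.size (max p q) -
    laverStar (2 ^ Nat.size (max p q)) (2 ^ Nat.size (max p q) - p)
      (2 ^ Nat.size (max p q) - q)

/-- The period `π(p)`: the least positive period of the sequence `p * q`, `q = 0, 1, 2, …`. -/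
noncomputable def laverPeriod (p : ℕ) : ℕ :=
  sInf {c : ℕ | 0 < c ∧ Function.Periodic (laverMul p) c}

/-- The number of ones in the binary expansion of `n`. -/
def bitCount (n : ℕ) : ℕ := (Nat.digits 2 n).count 1

/-- A positive integer `p` is maximal if `π(p) = 2 ^ bitCount (p - 1)`. -/
def IsMaximalElement (p : ℕ) : Prop :=
  0 < p ∧ laverPeriod p = 2 ^ bitCount (p - 1)

/-- The binary word `1 0^{b₀} 1^{2^{a₁}} 0^{b₁ 2^{a₁}} ⋯ 1^{2^{a_r}} 0^{b_r 2^{a_r}}`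
(most significant digit first). -/
def maximalWord (b₀ : ℕ) {r : ℕ} (a b : Fin r → ℕ) : List ℕ :=
  1 :: (List.replicate b₀ 0 ++
    (List.ofFn fun i : Fin r =>
      List.replicate (2 ^ a i) 1 ++ List.replicate (b i * 2 ^ a i) 0).flatten)

/-!
Write `p * q` for `laverMul p q`.  A power of two `N` makes every row of the table vanish at `0`, and
this is all that is needed for left distributivity and for reduction modulo `N` to be a homomorphism.
Reduction shows that every value `p * q` is a submask of `p - 1`, and that a new leading bit `2 ^ n`
of `p` either preserves the period or doubles it (`two_pow_add_dichotomy`).  So `π(p)` is at most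
`2 ^ bitCount (p - 1)`, and `p` is maximal exactly if each bit of the mask `p - 1` doubles the period
when it is added; then `p` acts on `q` by depositing the bits of `q` into the mask `p - 1`
(`IsMaximalMask.laverMul_eq`).  Because of the composition `(p * q + 1) * c = p * ((q + 1) * c)`,
depositing a mask into a maximal mask preserves and reflects maximality
(`IsMaximalMask.deposit_iff`), so that new maximal masks arise from old ones, and known masks can be
extracted from a given one.

In the word of the theorem each block of `h = 2 ^ a` ones starts, counted from the right, at a
multiple of `h`, and the digits on its left contain at most `h` ones.

*These masks are maximal.*  One has to insert an aligned block of `h` ones below a maximal mask with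
at most `h` ones (`IsMaximalMask.add_block`).  The crucial point is `hasSmallPeriods`: if `h` divides
`m`, an element with at most `h` ones above the position `m` and a nonzero part below it has a period
dividing `2 ^ m`.  Otherwise some leading bit would double the period `2 ^ m`; multiplying a
suitable identity `(2 ^ m + b) * c = 2 ^ m` by the element, distributivity leads to a smaller
element with the same property.  It follows that a maximal mask above `m` with at most `h` ones may
be filled up by all positions below `m`, and, by depositing an interval into the result, that it
may be completed by the block alone.

*There are no others.*  By extracting submasks it suffices to see that the lowest `h` ones of a
maximal mask with `h + 1` ones form an aligned block (`IsMaximalMask.eq_block`).  By induction on `h`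
the lowest `2 * h` ones form two aligned blocks of `h` ones, at `u * h` and `v * h`, and
distributivity rules out all cases except `v = u + 1` with `u` even (`even_and_eq_succ_of_row`).
-/

/-! ### The reflected tables -/

/-- The reflected Laver table `p * q = N - (N - p) ⋆ (N - q)` for a fixed `N`, meaningful for
`p, q < N`. -/
def reflTable (N p q : ℕ) : ℕ := N - laverStar N (N - p) (N - q)

theorem reflTable_zero_left {N q : ℕ} (hq : q < N) : reflTable N 0 q = q := by
  unfold reflTable
  rw [Nat.sub_zero, laverStar_last]; omega

theorem reflTable_lt {N p q : ℕ} (hp : 0 < p) (hpN : p ≤ N) (hq : q < N) :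
    reflTable N p q < p := by
  have := laverStar_bounds (N := N) (p := N - p) (q := N - q) (by omega) (by omega)
  unfold reflTable; omega

theorem reflTable_pred {N p : ℕ} (hp : 0 < p) (hpN : p < N) : reflTable N p (N - 1) = p - 1 := by
  unfold reflTable
  rw [show N - (N - 1) = 1 by omega, laverStar_one (by omega)]; omega

theorem reflTable_rec {N p q : ℕ} (hp : 0 < p) (hpN : p < N) (hq : q + 1 < N) :
    reflTable N p q = reflTable N (reflTable N p (q + 1)) (p - 1) := by
  have hb := laverStar_bounds (N := N) (p := N - p) (q := N - (q + 1)) (by omega) (by omega)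
  have h := laverStar_succ (N := N) (p := N - p) (q := N - (q + 1)) (by omega) (by omega)
    (by omega)
  unfold reflTable
  rw [show N - q = N - (q + 1) + 1 by omega, h, laverStar_one (by omega)]
  congr 2 <;> omega

/-- Every row of the reflected table vanishes at `0`.  Equivalently `p ⋆ N = N` for all `p`; this
is what distinguishes the powers of two. -/
def ZeroColumn (N : ℕ) : Prop := ∀ p < N, reflTable N p 0 = 0

/-- Reduction modulo `N` is a homomorphism onto the reflected table of size `N`. -/
theorem reflTable_mod {N N' : ℕ} (hN : 0 < N) (hd : N ∣ N') (h0 : ZeroColumn N) :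
    ∀ p q : ℕ, p < N' → q < N' →
      reflTable N' p q % N = reflTable N (p % N) (q % N) := by
  obtain ⟨t, rfl⟩ := hd
  intro p
  induction p using Nat.strong_induction_on with
  | _ p ihp =>
  intro q hp hq
  have hpN := Nat.mod_lt p hN
  rcases Nat.eq_zero_or_pos p with rfl | hp0
  · rw [reflTable_zero_left hq, Nat.zero_mod, reflTable_zero_left (Nat.mod_lt _ hN)]
  have hsuc : ∀ q, (((q + 1) % N = 0 → q % N = N - 1) ∧
      ((q + 1) % N ≠ 0 → (q + 1) % N = q % N + 1)) := by
    intro k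
    have h2 := Nat.mod_lt k hN
    rw [← Nat.mod_add_mod]
    rcases Nat.lt_or_ge (k % N + 1) N with h | h
    · rw [Nat.mod_eq_of_lt h]; omega
    · rw [show k % N + 1 = N by omega, Nat.mod_self]; omega
  have hpred : (p % N = 0 → (p - 1) % N = N - 1) ∧ (p % N ≠ 0 → (p - 1) % N = p % N - 1) := by
    have := hsuc (p - 1)
    rw [show p - 1 + 1 = p by omega] at this
    omega
  obtain ⟨j, hj⟩ : ∃ j, q + 1 + j = N * t := ⟨N * t - (q + 1), by omega⟩
  induction j generalizing q with
  | zero =>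
    have hq1 : q = N * t - 1 := by omega
    have hqm : q % N = N - 1 := (hsuc q).1 (by rw [show q + 1 = N * t by omega]; simp)
    rw [hqm, hq1, reflTable_pred hp0 hp]
    by_cases h : p % N = 0
    · rw [h, hpred.1 h, reflTable_zero_left (by omega)]
    · rw [hpred.2 h, reflTable_pred (by omega) hpN]
  | succ j ih =>
    have ih' := ih (q + 1) (by omega) (by omega)
    have hlt := reflTable_lt hp0 hp.le (show q + 1 < N * t by omega)
    rw [reflTable_rec hp0 hp (by omega), ihp _ hlt _ (by omega) (by omega), ih']
    have hqN := Nat.mod_lt q hN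
    by_cases h : p % N = 0
    · rw [hpred.1 h, h, reflTable_zero_left hqN, reflTable_zero_left (Nat.mod_lt _ hN)]
      by_cases h' : (q + 1) % N = 0
      · rw [h', (hsuc q).1 h', reflTable_zero_left (by omega)]
      · rw [reflTable_pred (by omega) (Nat.mod_lt _ hN), (hsuc q).2 h']; omega
    · rw [hpred.2 h]
      by_cases h' : (q + 1) % N = 0
      · rw [h', (hsuc q).1 h', h0 _ hpN, reflTable_zero_left (by omega),
          reflTable_pred (by omega) hpN]
      · rw [(hsuc q).2 h', ← reflTable_rec (by omega) hpN]
        have := Nat.mod_lt (q + 1) hN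
        have := (hsuc q).2 h'
        omega

/-- The row of `p`, read from right to left, is the orbit of `0` under `v ↦ v * (p - 1)`. -/
theorem reflTable_eq_iterate {N p : ℕ} (hp : 0 < p) (hpN : p < N) {j : ℕ} (hj : j < N) :
    reflTable N p (N - 1 - j) = (fun v => reflTable N v (p - 1))^[j + 1] 0 := by
  induction j with
  | zero => simp [reflTable_pred hp hpN, reflTable_zero_left (show p - 1 < N by omega)]
  | succ j ih =>
    rw [Function.iterate_succ_apply', ← ih (by omega), reflTable_rec hp hpN (by omega)]
    congr 2; omega

theorem ZeroColumn.double {N : ℕ} (hN : 0 < N) (h0 : ZeroColumn N) : ZeroColumn (2 * N) := by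
  intro p hp
  rcases Nat.eq_zero_or_pos p with rfl | hp0
  · rw [reflTable_zero_left hp]
  set f : ℕ → ℕ := fun v => reflTable (2 * N) v (p - 1) with hf
  set g : ℕ → ℕ := fun v => reflTable N v ((p - 1) % N) with hg
  have hfv : ∀ v, 0 < v → v < 2 * N → f v < v := fun v h h' => reflTable_lt h h'.le (by omega)
  have hf2 : ∀ v, v < 2 * N → f v < 2 * N := by
    intro v hv
    rcases Nat.eq_zero_or_pos v with rfl | h
    · simp only [hf]; rw [reflTable_zero_left (by omega)]; omega
    · exact (hfv v h hv).trans hv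
  have key : ∀ j v, v < 2 * N → f^[j] v < 2 * N ∧ f^[j] v % N = g^[j] (v % N) := by
    intro j v hv
    induction j with
    | zero => exact ⟨hv, rfl⟩
    | succ j ih =>
      rw [Function.iterate_succ_apply', Function.iterate_succ_apply']
      exact ⟨hf2 _ ih.1, by
        rw [← ih.2]
        exact reflTable_mod hN ⟨2, by ring⟩ h0 _ _ ih.1 (by omega)⟩
  have hlast : reflTable (2 * N) p 0 = f^[2 * N] 0 := by
    have := reflTable_eq_iterate hp0 hp (j := 2 * N - 1) (by omega)
    rwa [Nat.sub_self, show 2 * N - 1 + 1 = 2 * N by omega] at this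
  have hgN : g^[N] 0 = 0 := by
    have h1 := reflTable_eq_iterate hp0 hp (j := N - 1) (by omega)
    rw [show 2 * N - 1 - (N - 1) = N by omega, show N - 1 + 1 = N by omega] at h1
    have h2 := (key N 0 (by omega)).2
    rw [← h1, reflTable_mod hN ⟨2, by ring⟩ h0 _ _ hp (by omega), Nat.mod_self,
      h0 _ (Nat.mod_lt _ hN), Nat.zero_mod] at h2
    exact h2.symm
  have hper : Function.IsPeriodicPt g N 0 := hgN
  set o := Function.minimalPeriod g 0 with ho
  have ho0 : 0 < o := hper.minimalPeriod_pos hN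
  have hoN : o ∣ N := hper.minimalPeriod_dvd
  have hgo : g^[o] 0 = 0 := Function.iterate_minimalPeriod
  have hmul : ∀ v, v < 2 * N → v % N = 0 → v = 0 ∨ v = N := by
    intro v hv h
    obtain ⟨k, rfl⟩ := Nat.dvd_of_mod_eq_zero h
    have : k < 2 := by
      by_contra hk
      nlinarith
    interval_cases k <;> simp
  rw [hlast]
  -- After `o` steps the orbit of `0` is at `0` or at `N`; from `N` it decreases below `N` and
  -- meets no multiple of `N` before step `o`, so that it is then at `0`.
  have h2o : f^[2 * o] 0 = 0 := by
    rw [two_mul, Function.iterate_add_apply]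
    have h1 := key o 0 (by omega)
    rw [Nat.zero_mod, hgo] at h1
    rcases hmul _ h1.1 h1.2 with h | h
    · rw [h, h]
    · rw [h]
      have hdec : ∀ j, 0 < j → j ≤ o → f^[j] N < N := by
        intro j hj
        induction j, hj using Nat.le_induction with
        | base => exact fun _ => hfv N hN (by omega)
        | succ j hj ih =>
          intro hjo
          have hlt := ih (by omega)
          rw [Function.iterate_succ_apply']
          refine (hfv _ (Nat.pos_of_ne_zero fun h0' => ?_) (by omega)).trans hlt
          have h3 := (key j N (by omega)).2
          rw [h0', Nat.zero_mod, Nat.mod_self] at h3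
          have : Function.IsPeriodicPt g j 0 := h3.symm
          have := this.minimalPeriod_le (by omega)
          omega
      have h4 := key o N (by omega)
      rw [Nat.mod_self, hgo] at h4
      have h5 := hdec o ho0 le_rfl
      rw [Nat.mod_eq_of_lt h5] at h4
      exact h4.2
  have : Function.IsPeriodicPt f (2 * o) 0 := h2o
  exact this.trans_dvd (Nat.mul_dvd_mul_left 2 hoN)

theorem zeroColumn_two_pow (n : ℕ) : ZeroColumn (2 ^ n) := by
  induction n with
  | zero =>
    intro p hp
    rw [show p = 0 by omega, reflTable_zero_left (by simp)]
  | succ n ih =>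
    rw [pow_succ, mul_comm]
    exact ih.double (by positivity)

theorem reflTable_distrib {N : ℕ} (h0 : ZeroColumn N) : ∀ p q r : ℕ, p < N → q < N → r < N →
    reflTable N p (reflTable N q r) = reflTable N (reflTable N p q) (reflTable N p r) := by
  intro p
  induction p using Nat.strong_induction_on with
  | _ p ihp =>
  intro q
  induction q using Nat.strong_induction_on with
  | _ q ihq =>
  intro r hp hq hr
  have hlt : ∀ {a b}, a < N → b < N → reflTable N a b < N := by
    intro a b ha hb
    rcases Nat.eq_zero_or_pos a with rfl | h
    · rwa [reflTable_zero_left hb]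
    · exact (reflTable_lt h ha.le hb).trans ha
  rcases Nat.eq_zero_or_pos p with rfl | hp0
  · rw [reflTable_zero_left (hlt hq hr), reflTable_zero_left hq, reflTable_zero_left hr]
  rcases Nat.eq_zero_or_pos q with rfl | hq0
  · rw [reflTable_zero_left hr, h0 p hp, reflTable_zero_left (hlt hp hr)]
  obtain ⟨j, hj⟩ : ∃ j, r + 1 + j = N := ⟨N - (r + 1), by omega⟩
  induction j generalizing r with
  | zero =>
    rw [show r = N - 1 by omega, reflTable_pred hq0 hq, reflTable_pred hp0 hp,
      reflTable_rec hp0 hp (by omega), show q - 1 + 1 = q by omega]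
  | succ j ih =>
    have ih' := ih (r + 1) (by omega) (by omega)
    have hq' := reflTable_lt hq0 hq.le (show r + 1 < N by omega)
    have hA := reflTable_lt hp0 hp.le hq
    have hB : reflTable N p (r + 1) < N := hlt hp (by omega)
    rw [reflTable_rec hq0 hq (by omega), ihq _ hq' _ hp (by omega) (by omega), ih',
      reflTable_rec (q := q - 1) hp0 hp (by omega), show q - 1 + 1 = q by omega,
      ← ihp _ hA _ _ (by omega) hB (by omega), ← reflTable_rec hp0 hp (by omega)]

/-! ### The operation on the natural numbers -/

local infixl:70 " ⋄ " => laverMul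

theorem laverMul_eq_reflTable {n p q : ℕ} (hp : p < 2 ^ n) (hq : q < 2 ^ n) :
    p ⋄ q = reflTable (2 ^ n) p q := by
  have hs := Nat.lt_size_self (max p q)
  have hle : Nat.size (max p q) ≤ n := Nat.size_le.2 (max_lt hp hq)
  have hp' : p < 2 ^ Nat.size (max p q) := (le_max_left _ _).trans_lt hs
  have hq' : q < 2 ^ Nat.size (max p q) := (le_max_right _ _).trans_lt hs
  have h := reflTable_mod (by positivity) (pow_dvd_pow 2 hle) (zeroColumn_two_pow _) p q hp hq
  rw [Nat.mod_eq_of_lt hp', Nat.mod_eq_of_lt hq', Nat.mod_eq_of_lt] at h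
  · exact h.symm
  · rcases Nat.eq_zero_or_pos p with rfl | h
    · rwa [reflTable_zero_left hq]
    · exact (reflTable_lt h hp.le hq).trans hp'

theorem exists_lt_two_pow (p q r : ℕ) : ∃ n, p < 2 ^ n ∧ q < 2 ^ n ∧ r < 2 ^ n := by
  have := Nat.lt_two_pow_self (n := p + q + r)
  exact ⟨p + q + r, by omega, by omega, by omega⟩

@[simp] theorem zero_laverMul (q : ℕ) : 0 ⋄ q = q := by
  obtain ⟨n, h0, h1, -⟩ := exists_lt_two_pow 0 q 0
  rw [laverMul_eq_reflTable h0 h1, reflTable_zero_left h1]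

@[simp] theorem laverMul_zero (p : ℕ) : p ⋄ 0 = 0 := by
  obtain ⟨n, h0, h1, -⟩ := exists_lt_two_pow p 0 0
  rw [laverMul_eq_reflTable h0 h1, zeroColumn_two_pow n p h0]

theorem laverMul_lt {p : ℕ} (q : ℕ) (hp : 0 < p) : p ⋄ q < p := by
  obtain ⟨n, h0, h1, -⟩ := exists_lt_two_pow p q 0
  rw [laverMul_eq_reflTable h0 h1]
  exact reflTable_lt hp h0.le h1

theorem laverMul_rec {p : ℕ} (q : ℕ) (hp : 0 < p) : p ⋄ q = (p ⋄ (q + 1)) ⋄ (p - 1) := by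
  obtain ⟨n, h0, h1, -⟩ := exists_lt_two_pow p (q + 1) 0
  have := laverMul_lt (q + 1) hp
  rw [laverMul_eq_reflTable (p := p ⋄ (q + 1)) (n := n) (by omega) (by omega),
    laverMul_eq_reflTable h0 h1, laverMul_eq_reflTable h0 (by omega), reflTable_rec hp h0 h1]

theorem laverMul_mod (n p q : ℕ) : (p ⋄ q) % 2 ^ n = (p % 2 ^ n) ⋄ (q % 2 ^ n) := by
  obtain ⟨k, h0, h1, h2⟩ := exists_lt_two_pow p q n
  have hn : 2 ^ n ∣ 2 ^ (n + k) := pow_dvd_pow 2 (by omega)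
  have hk : 2 ^ k ≤ 2 ^ (n + k) := Nat.pow_le_pow_right (by simp) (by omega)
  rw [laverMul_eq_reflTable (n := n + k) (by omega) (by omega),
    reflTable_mod (by positivity) hn (zeroColumn_two_pow n) p q (by omega) (by omega),
    ← laverMul_eq_reflTable (Nat.mod_lt _ (by positivity)) (Nat.mod_lt _ (by positivity))]

/-- Left self-distributivity. -/
theorem laverMul_distrib (p q r : ℕ) : p ⋄ (q ⋄ r) = (p ⋄ q) ⋄ (p ⋄ r) := by
  obtain ⟨n, h0, h1, h2⟩ := exists_lt_two_pow p q r
  have hlt : ∀ {a b}, a < 2 ^ n → b < 2 ^ n → a ⋄ b < 2 ^ n := by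
    intro a b ha hb
    rcases Nat.eq_zero_or_pos a with rfl | h
    · rwa [zero_laverMul]
    · exact (laverMul_lt b h).trans ha
  rw [laverMul_eq_reflTable h0 (hlt h1 h2), laverMul_eq_reflTable (hlt h0 h1) (hlt h0 h2),
    laverMul_eq_reflTable h1 h2, laverMul_eq_reflTable h0 h1, laverMul_eq_reflTable h0 h2,
    reflTable_distrib (zeroColumn_two_pow n) p q r h0 h1 h2]

/-! ### Periods -/

theorem two_pow_laverMul (n q : ℕ) : 2 ^ n ⋄ q = q % 2 ^ n := by
  have h := laverMul_mod n (2 ^ n) q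
  rwa [Nat.mod_self, zero_laverMul, Nat.mod_eq_of_lt (laverMul_lt q (by positivity))] at h

theorem laverMul_mod_of_le {n p : ℕ} (hp : 0 < p) (hpn : p ≤ 2 ^ n) (q : ℕ) :
    p ⋄ (q % 2 ^ n) = p ⋄ q := by
  rcases hpn.lt_or_eq with h | rfl
  · have h1 := laverMul_mod n p q
    rw [Nat.mod_eq_of_lt h, Nat.mod_eq_of_lt ((laverMul_lt q hp).trans h)] at h1
    exact h1.symm
  · rw [two_pow_laverMul, two_pow_laverMul, Nat.mod_mod]

theorem laverMul_eq_iterate {n p : ℕ} (hp : 0 < p) (hpn : p ≤ 2 ^ n) (t : ℕ) {j : ℕ}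
    (hj : j ≤ 2 ^ n * t) : p ⋄ (2 ^ n * t - j) = (fun v => v ⋄ (p - 1))^[j] 0 := by
  induction j with
  | zero =>
    rw [Nat.sub_zero, ← laverMul_mod_of_le hp hpn, Nat.mul_mod_right, laverMul_zero]; rfl
  | succ j ih =>
    rw [Function.iterate_succ_apply', ← ih (by omega), laverMul_rec _ hp]
    congr 2; omega

/-- The base `2` logarithm of the period `π(p)`. -/
noncomputable def laverExp (p : ℕ) : ℕ := Nat.log 2 (laverPeriod p)

/-- The orbit of `0` under `v ↦ v * (p - 1)` is the row of `p` read from right to left, so its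
length is the period of `p`; it divides each power of two that is at least `p`. -/
theorem laverPeriod_spec {n p : ℕ} (hp : 0 < p) (hpn : p ≤ 2 ^ n) :
    laverPeriod p ∣ 2 ^ n ∧ ∀ a b, p ⋄ a = p ⋄ b ↔ a ≡ b [MOD laverPeriod p] := by
  set f : ℕ → ℕ := fun v => v ⋄ (p - 1) with hf
  have hit : ∀ t j, j ≤ 2 ^ n * t → p ⋄ (2 ^ n * t - j) = f^[j] 0 :=
    fun t j hj => laverMul_eq_iterate hp hpn t hj
  have hN : 0 < 2 ^ n := by positivity
  have hper : Function.IsPeriodicPt f (2 ^ n) 0 := by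
    have := hit 1 (2 ^ n) (by omega)
    rw [mul_one, Nat.sub_self, laverMul_zero] at this
    exact this.symm
  set o := Function.minimalPeriod f 0 with ho
  have ho0 : 0 < o := hper.minimalPeriod_pos hN
  have hoN : o ∣ 2 ^ n := hper.minimalPeriod_dvd
  have hfi : ∀ i j, f^[i] 0 = f^[j] 0 ↔ i ≡ j [MOD o] := by
    intro i j
    rw [← Function.iterate_mod_minimalPeriod_eq (n := i),
      ← Function.iterate_mod_minimalPeriod_eq (n := j)]
    exact ⟨fun h => Function.iterate_injOn_Iio_minimalPeriod (Nat.mod_lt _ ho0)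
      (Nat.mod_lt _ ho0) h, fun h => by rw [← ho, h]⟩
  have main : ∀ a b, p ⋄ a = p ⋄ b ↔ a ≡ b [MOD o] := by
    intro a b
    set T := 2 ^ n * (a + b) with hT
    have hTle : a + b ≤ T := Nat.le_mul_of_pos_left _ hN
    have h1 := hit (a + b) (T - a) (by omega)
    have h2 := hit (a + b) (T - b) (by omega)
    rw [← hT, show T - (T - a) = a by omega] at h1
    rw [← hT, show T - (T - b) = b by omega] at h2
    rw [h1, h2, hfi]
    constructor
    · intro h
      have h' := h.add_right (a + b)
      rw [show T - a + (a + b) = T + b by omega, show T - b + (a + b) = T + a by omega] at h'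
      exact (Nat.ModEq.add_left_cancel' T h').symm
    · intro h
      refine Nat.ModEq.add_right_cancel h ?_
      rw [show T - a + a = T by omega, show T - b + b = T by omega]
  have hP : laverPeriod p = o := by
    refine IsLeast.csInf_eq ⟨⟨ho0, fun q => (main _ _).2 (by simp [Nat.ModEq])⟩, ?_⟩
    rintro c ⟨hc, hper⟩
    have := (main _ _).1 (hper 0)
    exact Nat.le_of_dvd hc ((Nat.modEq_zero_iff_dvd).1 (by simpa using this))
  rw [hP]
  exact ⟨hoN, main⟩

theorem laverPeriod_eq {p : ℕ} (hp : 0 < p) : laverPeriod p = 2 ^ laverExp p := by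
  obtain ⟨k, -, h⟩ := (Nat.dvd_prime_pow Nat.prime_two).1
    (laverPeriod_spec hp (Nat.lt_two_pow_self (n := p)).le).1
  rw [laverExp, h, Nat.log_pow (by norm_num)]

theorem laverExp_le {n p : ℕ} (hp : 0 < p) (hpn : p ≤ 2 ^ n) : laverExp p ≤ n := by
  have h := (laverPeriod_spec hp hpn).1
  rw [laverPeriod_eq hp] at h
  exact (Nat.pow_dvd_pow_iff_le_right (by norm_num)).1 h

theorem laverMul_eq_iff {p a b : ℕ} (hp : 0 < p) :
    p ⋄ a = p ⋄ b ↔ a ≡ b [MOD 2 ^ laverExp p] := by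
  rw [← laverPeriod_eq hp]
  exact (laverPeriod_spec hp (Nat.lt_two_pow_self (n := p)).le).2 a b

theorem laverMul_eq_zero_iff {p a : ℕ} (hp : 0 < p) : p ⋄ a = 0 ↔ 2 ^ laverExp p ∣ a := by
  rw [← Nat.modEq_zero_iff_dvd, ← laverMul_eq_iff hp, laverMul_zero]

theorem laverMul_mod_two_pow {m p : ℕ} (hp : 0 < p) (h : laverExp p ≤ m) (q : ℕ) :
    p ⋄ (q % 2 ^ m) = p ⋄ q :=
  (laverMul_eq_iff hp).2 ((Nat.mod_modEq q _).of_dvd (pow_dvd_pow 2 h))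

theorem laverMul_strictMono {p a b : ℕ} (hp : 0 < p) (hab : a < b) (hb : b < 2 ^ laverExp p) :
    p ⋄ a < p ⋄ b := by
  induction b, hab using Nat.le_induction with
  | base =>
    rw [laverMul_rec a hp]
    refine laverMul_lt _ (Nat.pos_of_ne_zero fun h => ?_)
    exact Nat.not_dvd_of_pos_of_lt (by omega) hb ((laverMul_eq_zero_iff hp).1 h)
  | succ b hab ih =>
    refine (ih (by omega)).trans ?_
    rw [laverMul_rec b hp]
    refine laverMul_lt _ (Nat.pos_of_ne_zero fun h => ?_)
    exact Nat.not_dvd_of_pos_of_lt (by omega) hb ((laverMul_eq_zero_iff hp).1 h)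

/-- If the period of `p` divides `2 ^ m`, then `p * (-1) = p - 1`, with `-1` taken modulo
`2 ^ m`. -/
theorem laverMul_neg_one {m p : ℕ} (hp : 0 < p) (h : laverExp p ≤ m) {q : ℕ}
    (hq : 2 ^ m ∣ q + 1) : p ⋄ q = p - 1 := by
  rw [laverMul_rec q hp, (laverMul_eq_zero_iff hp).2 ((pow_dvd_pow 2 h).trans hq), zero_laverMul]

theorem laverExp_eq_of_forall {p k : ℕ} (hp : 0 < p) (h : ∀ a, p ⋄ a = 0 ↔ 2 ^ k ∣ a) :
    laverExp p = k := by
  refine Nat.pow_right_injective le_rfl (Nat.dvd_antisymm ?_ ?_)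
  · exact (laverMul_eq_zero_iff hp).1 ((h _).2 dvd_rfl)
  · exact (h _).1 ((laverMul_eq_zero_iff hp).2 dvd_rfl)

/-! ### Adding a leading bit -/

theorem two_pow_add_laverMul_mod {n x : ℕ} (hx : 0 < x) (hxn : x ≤ 2 ^ n) (q : ℕ) :
    ((2 ^ n + x) ⋄ q) % 2 ^ n = x ⋄ q := by
  rw [laverMul_mod, Nat.add_mod_left]
  rcases hxn.lt_or_eq with h | rfl
  · rw [Nat.mod_eq_of_lt h, laverMul_mod_of_le hx hxn]
  · rw [Nat.mod_self, zero_laverMul, two_pow_laverMul]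

theorem two_pow_add_laverMul_cases {n x : ℕ} (hx : 0 < x) (hxn : x ≤ 2 ^ n) (q : ℕ) :
    (2 ^ n + x) ⋄ q = x ⋄ q ∨ (2 ^ n + x) ⋄ q = 2 ^ n + x ⋄ q := by
  have h1 := two_pow_add_laverMul_mod hx hxn q
  have h2 := laverMul_lt q (show 0 < 2 ^ n + x by omega)
  rcases Nat.lt_or_ge ((2 ^ n + x) ⋄ q) (2 ^ n) with h | h
  · left; rw [← h1, Nat.mod_eq_of_lt h]
  · right
    rw [← h1, Nat.mod_eq_sub_mod h, Nat.mod_eq_of_lt (by omega)]; omega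

/-- Adding a leading bit either preserves the period or doubles it; in the second case the new
bit of the product is the bit of the right factor at the position of the old exponent. -/
theorem two_pow_add_dichotomy {n x : ℕ} (hx : 0 < x) (hxn : x ≤ 2 ^ n) :
    laverExp (2 ^ n + x) = laverExp x ∨
      laverExp (2 ^ n + x) = laverExp x + 1 ∧
        ∀ q, (2 ^ n + x) ⋄ q = 2 ^ n * (q / 2 ^ laverExp x % 2) + x ⋄ q := by
  have hp : 0 < 2 ^ n + x := by omega
  set k := laverExp x with hk
  have hN : 0 < 2 ^ n := by positivity
  have hK : 0 < 2 ^ k := by positivity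
  have hx0 : x ⋄ 2 ^ k = 0 := (laverMul_eq_zero_iff hx).2 dvd_rfl
  have hdvd : ∀ a, (2 ^ n + x) ⋄ a = 0 → 2 ^ k ∣ a := by
    intro a ha
    have := two_pow_add_laverMul_mod hx hxn a
    rw [ha, Nat.zero_mod] at this
    exact (laverMul_eq_zero_iff hx).1 this.symm
  rcases two_pow_add_laverMul_cases hx hxn (2 ^ k) with h | h <;> rw [hx0] at h
  · left
    refine laverExp_eq_of_forall hp fun a => ⟨hdvd a, fun ha => ?_⟩
    exact (laverMul_eq_zero_iff hp).2 (((laverMul_eq_zero_iff hp).1 h).trans ha)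
  · right
    have he : laverExp (2 ^ n + x) = k + 1 := by
      have hne : ¬ 2 ^ laverExp (2 ^ n + x) ∣ 2 ^ k := fun hd => by
        have := (laverMul_eq_zero_iff hp).2 hd
        omega
      have h2 : (2 ^ n + x) ⋄ 2 ^ (k + 1) = 0 := by
        rcases two_pow_add_laverMul_cases hx hxn (2 ^ (k + 1)) with h' | h' <;>
          rw [(laverMul_eq_zero_iff hx).2 (pow_dvd_pow 2 (Nat.le_succ k))] at h'
        · exact h'
        · refine absurd ?_ hne
          have := (laverMul_eq_iff hp).1 (h'.trans h.symm)
          rw [pow_succ, mul_two] at this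
          exact Nat.modEq_zero_iff_dvd.1 (Nat.ModEq.add_left_cancel' (2 ^ k) (by simpa using this))
      have h3 := (Nat.pow_dvd_pow_iff_le_right (by norm_num)).1 ((laverMul_eq_zero_iff hp).1 h2)
      rw [Nat.pow_dvd_pow_iff_le_right (by norm_num)] at hne
      omega
    refine ⟨he, fun q => ?_⟩
    have hK2 : 2 ^ (k + 1) = 2 ^ k * 2 := pow_succ 2 k
    have hlt : q % 2 ^ (k + 1) < 2 ^ (k + 1) := Nat.mod_lt _ (by positivity)
    have hdm : q % 2 ^ (k + 1) = q % 2 ^ k + 2 ^ k * (q / 2 ^ k % 2) := by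
      rw [hK2, Nat.mod_mul]
    have hqk : q % 2 ^ k < 2 ^ k := Nat.mod_lt _ hK
    have hc := two_pow_add_laverMul_cases hx hxn q
    have hxlt := laverMul_lt q hx
    have hred := laverMul_mod_two_pow hp he.le q
    rcases Nat.mod_two_eq_zero_or_one (q / 2 ^ k) with h0 | h1
    · rw [h0] at hdm
      have := laverMul_strictMono hp (show q % 2 ^ (k + 1) < 2 ^ k by omega)
        (by rw [he]; omega)
      rw [hred, h] at this
      rw [h0]
      omega
    · rw [h1] at hdm
      have : 2 ^ n ≤ (2 ^ n + x) ⋄ q := by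
        rw [← hred]
        rcases (show 2 ^ k ≤ q % 2 ^ (k + 1) by omega).eq_or_lt with h4 | h4
        · rw [← h4, h]; omega
        · have := laverMul_strictMono hp h4 (by rw [he]; omega)
          omega
      rw [h1]
      omega

/-! ### Binary expansions -/

theorem bitCount_rec (x : ℕ) : bitCount x = x % 2 + bitCount (x / 2) := by
  unfold bitCount
  rcases Nat.eq_zero_or_pos x with rfl | h
  · simp
  · rw [Nat.digits_def' (by norm_num) h, List.count_cons]
    rcases Nat.mod_two_eq_zero_or_one x with h | h <;> simp [h, add_comm]

@[simp] theorem bitCount_zero : bitCount 0 = 0 := by simp [bitCount]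

theorem bitCount_append {a x₀ : ℕ} (x₁ : ℕ) (h : x₀ < 2 ^ a) :
    bitCount (2 ^ a * x₁ + x₀) = bitCount x₁ + bitCount x₀ := by
  induction a generalizing x₀ with
  | zero => simp [show x₀ = 0 by simpa using h]
  | succ a ih =>
    have h' : x₀ / 2 < 2 ^ a := by rw [pow_succ] at h; omega
    have e : 2 ^ (a + 1) * x₁ = 2 * (2 ^ a * x₁) := by ring
    rw [bitCount_rec (_ + _), bitCount_rec x₀, e,
      show (2 * (2 ^ a * x₁) + x₀) / 2 = 2 ^ a * x₁ + x₀ / 2 by omega, ih h',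
      show (2 * (2 ^ a * x₁) + x₀) % 2 = x₀ % 2 by omega]
    ring

theorem bitCount_two_pow_mul (a x : ℕ) : bitCount (2 ^ a * x) = bitCount x := by
  simpa using bitCount_append x (show 0 < 2 ^ a by positivity)

theorem bitCount_one : bitCount 1 = 1 := by simp [bitCount]

theorem bitCount_two_pow (a : ℕ) : bitCount (2 ^ a) = 1 := by
  simpa [bitCount_one] using bitCount_two_pow_mul a 1

theorem bitCount_two_pow_sub_one (a : ℕ) : bitCount (2 ^ a - 1) = a := by
  induction a with
  | zero => simp
  | succ a ih =>
    have := Nat.one_le_two_pow (n := a)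
    rw [bitCount_rec, show (2 ^ (a + 1) - 1) / 2 = 2 ^ a - 1 by rw [pow_succ]; omega,
      show (2 ^ (a + 1) - 1) % 2 = 1 by rw [pow_succ]; omega, ih]
    ring

theorem bitCount_le {a x : ℕ} (h : x < 2 ^ a) : bitCount x ≤ a := by
  induction a generalizing x with
  | zero => simp [show x = 0 by simpa using h]
  | succ a ih =>
    rw [bitCount_rec]
    have := ih (x := x / 2) (by rw [pow_succ] at h; omega)
    omega

theorem bitCount_lt {a x : ℕ} (h : x + 1 < 2 ^ a) : bitCount x < a := by
  induction a generalizing x with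
  | zero => simp at h
  | succ a ih =>
    rw [bitCount_rec]
    rw [pow_succ] at h
    rcases Nat.mod_two_eq_zero_or_one x with h0 | h1
    · have := bitCount_le (x := x / 2) (a := a) (by omega)
      omega
    · have := ih (x := x / 2) (by omega)
      omega

theorem bitCount_eq_zero {x : ℕ} (h : bitCount x = 0) : x = 0 := by
  induction x using Nat.strong_induction_on with
  | _ x ih =>
    by_contra hx
    rw [bitCount_rec] at h
    have := ih (x / 2) (by omega) (by omega)
    omega

/-- The binary digits of `v` are bounded by those of `x`. -/
def IsSubmask (v x : ℕ) : Prop := ∀ i, v.testBit i → x.testBit i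

theorem IsSubmask.div {v x : ℕ} (h : IsSubmask v x) (m : ℕ) :
    IsSubmask (v / 2 ^ m) (x / 2 ^ m) := by
  intro i
  rw [Nat.testBit_div_two_pow, Nat.testBit_div_two_pow]
  exact h _

theorem IsSubmask.mod {v x : ℕ} (h : IsSubmask v x) (m : ℕ) :
    IsSubmask (v % 2 ^ m) (x % 2 ^ m) := by
  intro i
  rw [Nat.testBit_mod_two_pow, Nat.testBit_mod_two_pow]
  have := h i
  simp only [Bool.and_eq_true]
  tauto

theorem IsSubmask.le {v x : ℕ} (h : IsSubmask v x) : v ≤ x := by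
  have : v &&& x = v := Nat.eq_of_testBit_eq fun i => by
    rw [Nat.testBit_and]
    have := h i
    cases hv : v.testBit i <;> simp_all
  exact this ▸ Nat.and_le_right

theorem IsSubmask.bitCount_le {v x : ℕ} (h : IsSubmask v x) : bitCount v ≤ bitCount x := by
  induction x using Nat.strong_induction_on generalizing v with
  | _ x ih =>
    have hle := h.le
    rcases Nat.eq_zero_or_pos x with rfl | hx
    · rw [show v = 0 by omega]
    · rw [bitCount_rec v, bitCount_rec x]
      have h1 := ih (x / 2) (by omega) (by simpa using h.div 1)
      have h2 := (h.mod 1).le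
      rw [pow_one] at h2
      omega

/-- All values in the row of `p` are submasks of `p - 1`. -/
theorem laverMul_isSubmask {p : ℕ} (hp : 0 < p) (q : ℕ) : IsSubmask (p ⋄ q) (p - 1) := by
  intro i hi
  have hN : 0 < 2 ^ i := by positivity
  have hN2 : 2 ^ (i + 1) = 2 ^ i * 2 := pow_succ 2 i
  have key : ∀ v, v.testBit i ↔ 2 ^ i ≤ v % 2 ^ (i + 1) := by
    intro v
    rw [Nat.testBit_eq_decide_div_mod_eq, decide_eq_true_eq, hN2, Nat.mod_mul]
    have := Nat.mod_lt v hN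
    rcases Nat.mod_two_eq_zero_or_one (v / 2 ^ i) with h | h <;> rw [h] <;> omega
  rw [key] at hi ⊢
  rw [laverMul_mod] at hi
  have hr := Nat.mod_lt p (show 0 < 2 ^ (i + 1) by positivity)
  have hdm := Nat.div_add_mod p (2 ^ (i + 1))
  rcases Nat.eq_zero_or_pos (p % 2 ^ (i + 1)) with h | h
  · obtain ⟨t, ht⟩ : ∃ t, p / 2 ^ (i + 1) = t + 1 := by
      refine ⟨p / 2 ^ (i + 1) - 1, ?_⟩
      have : p / 2 ^ (i + 1) ≠ 0 := fun h' => by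
        rw [h', h, mul_zero] at hdm; omega
      exact (Nat.succ_pred_eq_of_ne_zero this).symm
    rw [ht, h, mul_add] at hdm
    rw [show p - 1 = 2 ^ (i + 1) - 1 + 2 ^ (i + 1) * t by omega, Nat.add_mul_mod_self_left,
      Nat.mod_eq_of_lt (by omega)]
    omega
  · have := laverMul_lt (q % 2 ^ (i + 1)) h
    rw [show p - 1 = p % 2 ^ (i + 1) - 1 + 2 ^ (i + 1) * (p / 2 ^ (i + 1)) by omega,
      Nat.add_mul_mod_self_left, Nat.mod_eq_of_lt (by omega)]
    omega

theorem exists_leading_bit {x : ℕ} (hx : 0 < x) : ∃ n x', x' < 2 ^ n ∧ x = 2 ^ n + x' := by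
  refine ⟨Nat.log 2 x, x - 2 ^ Nat.log 2 x, ?_, ?_⟩
  · have := Nat.lt_pow_succ_log_self (b := 2) (by norm_num) x
    rw [pow_succ] at this
    have := Nat.pow_log_le_self 2 hx.ne'
    omega
  · have := Nat.pow_log_le_self 2 hx.ne'
    omega

theorem bitCount_two_pow_add {n x : ℕ} (h : x < 2 ^ n) :
    bitCount (2 ^ n + x) = bitCount x + 1 := by
  have := bitCount_append 1 h
  rw [mul_one, bitCount_one] at this
  omega

theorem laverExp_append_le {m x₀ : ℕ} (y : ℕ) (h0 : 0 < x₀) (hm : x₀ ≤ 2 ^ m) :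
    laverExp (2 ^ m * y + x₀) ≤ laverExp x₀ + bitCount y := by
  induction y using Nat.strong_induction_on with
  | _ y ih =>
    rcases Nat.eq_zero_or_pos y with rfl | hy
    · simp
    obtain ⟨l, y', hy', rfl⟩ := exists_leading_bit hy
    have h1 := ih y' (by have : 0 < 2 ^ l := by positivity
                         omega)
    have hle : 2 ^ m * y' + x₀ ≤ 2 ^ (m + l) := by
      rw [pow_add]; nlinarith
    rw [show 2 ^ m * (2 ^ l + y') + x₀ = 2 ^ (m + l) + (2 ^ m * y' + x₀) by ring,
      bitCount_two_pow_add hy']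
    rcases two_pow_add_dichotomy (by omega) hle with h | h <;> omega

theorem laverExp_succ_le_bitCount (x : ℕ) : laverExp (x + 1) ≤ bitCount x := by
  have h := laverExp_append_le (m := 0) x one_pos (by simp)
  have := laverExp_le (p := 1) (n := 0) one_pos (by simp)
  rw [pow_zero, one_mul] at h
  omega

/-! ### Depositing bits -/

/-- The bits of `y` written, in order, into the positions of the ones of the mask `x`. -/
def deposit (x y : ℕ) : ℕ :=
  if x = 0 then 0
  else if x % 2 = 1 then 2 * deposit (x / 2) (y / 2) + y % 2
  else 2 * deposit (x / 2) y
termination_by x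

@[simp] theorem deposit_zero_left (y : ℕ) : deposit 0 y = 0 := by rw [deposit]; simp

theorem deposit_append {a x₀ : ℕ} (x₁ y : ℕ) (h : x₀ < 2 ^ a) :
    deposit (2 ^ a * x₁ + x₀) y =
      2 ^ a * deposit x₁ (y / 2 ^ bitCount x₀) + deposit x₀ y := by
  induction a generalizing x₀ y with
  | zero => simp [show x₀ = 0 by simpa using h]
  | succ a ih =>
    have h' : x₀ / 2 < 2 ^ a := by rw [pow_succ] at h; omega
    have e : 2 ^ (a + 1) * x₁ = 2 * (2 ^ a * x₁) := by ring
    rcases Nat.eq_zero_or_pos (2 ^ (a + 1) * x₁ + x₀) with h0 | hpos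
    · obtain rfl : x₀ = 0 := by omega
      obtain rfl : x₁ = 0 := by
        have : 0 < 2 ^ (a + 1) := by positivity
        simpa using h0
      simp
    rw [deposit, if_neg hpos.ne', show (2 ^ (a + 1) * x₁ + x₀) / 2 = 2 ^ a * x₁ + x₀ / 2 by omega,
      ih _ h', ih _ h', show (2 ^ (a + 1) * x₁ + x₀) % 2 = x₀ % 2 by omega, bitCount_rec x₀]
    rcases Nat.eq_zero_or_pos x₀ with rfl | hx0
    · simp; ring
    rw [deposit.eq_def x₀, if_neg hx0.ne']
    rcases Nat.mod_two_eq_zero_or_one x₀ with h2 | h2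
    · simp [h2]; ring
    · simp only [h2, if_true, pow_add, pow_one, Nat.div_div_eq_div_mul]; ring

theorem deposit_two_pow_mul (a x y : ℕ) : deposit (2 ^ a * x) y = 2 ^ a * deposit x y := by
  simpa using deposit_append x y (show 0 < 2 ^ a by positivity)

theorem deposit_one (y : ℕ) : deposit 1 y = y % 2 := by
  rw [deposit]; simp

theorem deposit_two_pow_add {n x : ℕ} (y : ℕ) (h : x < 2 ^ n) :
    deposit (2 ^ n + x) y = 2 ^ n * (y / 2 ^ bitCount x % 2) + deposit x y := by
  simpa [deposit_one] using deposit_append 1 y h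

theorem deposit_two_pow_sub_one (k y : ℕ) : deposit (2 ^ k - 1) y = y % 2 ^ k := by
  induction k with
  | zero => simp [Nat.mod_one]
  | succ k ih =>
    have := Nat.one_le_two_pow (n := k)
    rw [show 2 ^ (k + 1) - 1 = 2 ^ k + (2 ^ k - 1) by rw [pow_succ]; omega,
      deposit_two_pow_add _ (by omega), ih, bitCount_two_pow_sub_one, pow_succ, Nat.mod_mul]
    ring

theorem deposit_mod {x k : ℕ} (hk : bitCount x ≤ k) (y : ℕ) :
    deposit x (y % 2 ^ k) = deposit x y := by
  induction x using Nat.strong_induction_on generalizing k y with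
  | _ x ih =>
    rcases Nat.eq_zero_or_pos x with rfl | hx
    · simp
    rw [bitCount_rec] at hk
    rw [deposit, deposit.eq_def x y, if_neg hx.ne', if_neg hx.ne']
    rcases Nat.mod_two_eq_zero_or_one x with h2 | h2
    · simp only [h2]
      rw [ih _ (by omega) (by omega)]
      rfl
    · obtain ⟨j, rfl⟩ : ∃ j, k = j + 1 := ⟨k - 1, by omega⟩
      simp only [h2, if_true]
      rw [Nat.mod_mod_of_dvd _ (dvd_pow_self 2 (by omega)),
        show y % 2 ^ (j + 1) / 2 = y / 2 % 2 ^ j by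
          rw [pow_succ, mul_comm, Nat.mod_mul_right_div_self], ih _ (by omega) (by omega)]

theorem deposit_self (x : ℕ) : deposit x (2 ^ bitCount x - 1) = x := by
  induction x using Nat.strong_induction_on with
  | _ x ih =>
    rcases Nat.eq_zero_or_pos x with rfl | hx
    · simp
    have h := ih (x / 2) (by omega)
    rw [deposit, if_neg hx.ne', bitCount_rec]
    rcases Nat.mod_two_eq_zero_or_one x with h2 | h2
    · simp only [h2, zero_add]; rw [h]; simp; omega
    · have := Nat.one_le_two_pow (n := bitCount (x / 2))
      simp only [h2, if_true, pow_add, pow_one]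
      rw [show (2 * 2 ^ bitCount (x / 2) - 1) / 2 = 2 ^ bitCount (x / 2) - 1 by omega, h]
      omega

theorem bitCount_deposit {x y : ℕ} (hy : y < 2 ^ bitCount x) :
    bitCount (deposit x y) = bitCount y := by
  induction x using Nat.strong_induction_on generalizing y with
  | _ x ih =>
    rcases Nat.eq_zero_or_pos x with rfl | hx
    · simp at hy; simp [hy]
    rw [bitCount_rec x] at hy
    rw [deposit, if_neg hx.ne']
    rcases Nat.mod_two_eq_zero_or_one x with h2 | h2
    · rw [h2, zero_add] at hy
      simp only [h2]
      have := bitCount_two_pow_mul 1 (deposit (x / 2) y)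
      rw [pow_one] at this
      simp [this, ih _ (by omega) hy]
    · rw [h2, pow_add] at hy
      simp only [h2, if_true]
      have := bitCount_append (a := 1) (deposit (x / 2) (y / 2)) (x₀ := y % 2) (by omega)
      rw [pow_one] at this
      rw [this, ih _ (by omega) (by omega), bitCount_rec y, bitCount_rec (y % 2)]
      simp [show y % 2 / 2 = 0 by omega]
      omega

/-! ### Maximal masks -/

/-- The mask `x` is maximal if the period of `x + 1` is `2 ^ bitCount x`, the largest possible
value. -/
def IsMaximalMask (x : ℕ) : Prop := laverExp (x + 1) = bitCount x

theorem isMaximalMask_zero : IsMaximalMask 0 := by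
  have := laverExp_succ_le_bitCount 0
  rw [bitCount_zero] at this
  rw [IsMaximalMask, bitCount_zero]; omega

/-- For a maximal mask `x`, the element `x + 1` acts by depositing bits into `x`. -/
theorem IsMaximalMask.laverMul_eq {x : ℕ} (hx : IsMaximalMask x) (y : ℕ) :
    (x + 1) ⋄ y = deposit x y := by
  induction x using Nat.strong_induction_on with
  | _ x ih =>
    rcases Nat.eq_zero_or_pos x with rfl | h0
    · have := laverMul_lt y one_pos
      simp; omega
    obtain ⟨n, x', hx', rfl⟩ := exists_leading_bit h0
    have hle := laverExp_succ_le_bitCount x'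
    have hd := two_pow_add_dichotomy (n := n) (Nat.succ_pos x') hx'
    rw [IsMaximalMask, bitCount_two_pow_add hx', add_assoc] at hx
    rcases hd with h | ⟨h, h'⟩
    · rw [Nat.succ_eq_add_one] at h
      omega
    · rw [Nat.succ_eq_add_one] at h h'
      have hmax : IsMaximalMask x' := by
        rw [IsMaximalMask]; omega
      rw [add_assoc, h', ih x' (by have : 0 < 2 ^ n := by positivity
                                   omega) hmax, deposit_two_pow_add _ hx', hmax]

theorem IsMaximalMask.of_two_pow_add {n x : ℕ} (hx : x < 2 ^ n)
    (h : IsMaximalMask (2 ^ n + x)) : IsMaximalMask x := by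
  have hle := laverExp_succ_le_bitCount x
  rw [IsMaximalMask, bitCount_two_pow_add hx, add_assoc] at h
  rcases two_pow_add_dichotomy (n := n) (Nat.succ_pos x) hx with h' | ⟨h', -⟩ <;>
  · rw [Nat.succ_eq_add_one] at h'
    rw [IsMaximalMask]; omega

theorem IsMaximalMask.mod {x : ℕ} (hx : IsMaximalMask x) (a : ℕ) :
    IsMaximalMask (x % 2 ^ a) := by
  induction x using Nat.strong_induction_on with
  | _ x ih =>
    rcases Nat.lt_or_ge x (2 ^ a) with h | h
    · rwa [Nat.mod_eq_of_lt h]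
    have : 0 < 2 ^ a := by positivity
    obtain ⟨n, x', hx', rfl⟩ := exists_leading_bit (show 0 < x by omega)
    have hn : a ≤ n := by
      by_contra hn
      have : 2 ^ (n + 1) ≤ 2 ^ a := Nat.pow_le_pow_right (by norm_num) (by omega)
      rw [pow_succ] at this
      omega
    have h1 := ih x' (by have : 0 < 2 ^ n := by positivity
                         omega) (hx.of_two_pow_add hx')
    obtain ⟨t, ht⟩ := pow_dvd_pow 2 hn
    rwa [ht, Nat.mul_add_mod]

/-- The composition `p ∘ q = p * (q - 1) + 1` acts as the composite of `p` and `q`. -/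
theorem laverMul_comp {p : ℕ} (hp : 0 < p) (y c : ℕ) :
    (p ⋄ y + 1) ⋄ c = p ⋄ ((y + 1) ⋄ c) := by
  obtain ⟨n, hc, hpn, hyn⟩ := exists_lt_two_pow c p y
  have hlt := laverMul_lt y hp
  -- Both sides follow the same recursion downwards from a multiple of all the periods.
  have key : ∀ j ≤ 2 ^ n, (p ⋄ y + 1) ⋄ (2 ^ n - j) = p ⋄ ((y + 1) ⋄ (2 ^ n - j)) := by
    intro j
    induction j with
    | zero =>
      intro _
      rw [Nat.sub_zero, ← laverMul_mod_of_le (n := n) (Nat.succ_pos _) (by omega),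
        ← laverMul_mod_of_le (n := n) (Nat.succ_pos y) (by omega)]
      simp
    | succ j ih =>
      intro hj
      rw [laverMul_rec _ (Nat.succ_pos (p ⋄ y)), laverMul_rec _ (Nat.succ_pos y),
        laverMul_distrib, show 2 ^ n - (j + 1) + 1 = 2 ^ n - j by omega]
      simp only [Nat.succ_eq_add_one, Nat.add_sub_cancel]
      rw [ih (by omega)]
  have := key (2 ^ n - c) (by omega)
  rwa [show 2 ^ n - (2 ^ n - c) = c by omega] at this

/-- The mask deposited by a maximal mask is maximal exactly if the given one is. -/
theorem IsMaximalMask.deposit_iff {x y : ℕ} (hx : IsMaximalMask x) (hy : y < 2 ^ bitCount x) :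
    IsMaximalMask (deposit x y) ↔ IsMaximalMask y := by
  have hcomp : ∀ c, (deposit x y + 1) ⋄ c = (x + 1) ⋄ ((y + 1) ⋄ c) := fun c => by
    rw [← hx.laverMul_eq, laverMul_comp (Nat.succ_pos x)]
  have hexp : laverExp (deposit x y + 1) = laverExp (y + 1) := by
    refine laverExp_eq_of_forall (Nat.succ_pos _) fun a => ?_
    rw [hcomp, laverMul_eq_zero_iff (Nat.succ_pos x), ← laverMul_eq_zero_iff (Nat.succ_pos y)]
    have hlt := laverMul_lt a (Nat.succ_pos y)
    rw [Nat.succ_eq_add_one, hx]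
    constructor
    · intro h
      exact Nat.eq_zero_of_dvd_of_lt h (by omega)
    · intro h
      rw [h]
      exact dvd_zero _
  rw [IsMaximalMask, IsMaximalMask, hexp, bitCount_deposit hy]

/-- A mask `x` is maximal as soon as depositing into `x` respects multiplication by the
generator. -/
theorem isMaximalMask_of_deposit {x : ℕ}
    (h : ∀ a, a + 1 < 2 ^ bitCount x → deposit x (a + 1) ⋄ x = deposit x a) :
    IsMaximalMask x := by
  set K := bitCount x with hK
  have hle : laverExp (x + 1) ≤ K := laverExp_succ_le_bitCount x
  have hpos : 0 < 2 ^ K := by positivity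
  have key : ∀ j < 2 ^ K, (x + 1) ⋄ (2 ^ K - 1 - j) = deposit x (2 ^ K - 1 - j) := by
    intro j
    induction j with
    | zero =>
      intro _
      rw [Nat.sub_zero, laverMul_neg_one (Nat.succ_pos x) hle, deposit_self]
      · rfl
      · rw [Nat.sub_add_cancel hpos]
    | succ j ih =>
      intro hj
      have hs : 2 ^ K - 1 - (j + 1) + 1 = 2 ^ K - 1 - j := by omega
      have h1 := h (2 ^ K - 1 - (j + 1)) (by omega)
      rw [hs] at h1
      rw [laverMul_rec _ (Nat.succ_pos x), hs, ih (by omega), ← h1]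
      rfl
  rcases hle.lt_or_eq with hlt | heq
  · exfalso
    have h2 : 2 ^ laverExp (x + 1) < 2 ^ K := Nat.pow_lt_pow_right (by norm_num) hlt
    have h0 : 0 < 2 ^ laverExp (x + 1) := by positivity
    have h1 := key (2 ^ K - 1 - 2 ^ laverExp (x + 1)) (by omega)
    rw [show 2 ^ K - 1 - (2 ^ K - 1 - 2 ^ laverExp (x + 1)) = 2 ^ laverExp (x + 1) by omega,
      (laverMul_eq_zero_iff (Nat.succ_pos x)).2 dvd_rfl] at h1
    have h3 := bitCount_deposit h2
    rw [← h1, bitCount_zero, bitCount_two_pow] at h3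
    omega
  · exact heq

/-- The masks `[0, k) ∪ {n}` with `k ≤ n` are maximal. -/
theorem isMaximalMask_two_pow_add_initial {k n : ℕ} (h : k ≤ n) :
    IsMaximalMask (2 ^ n + (2 ^ k - 1)) := by
  have hk : 0 < 2 ^ k := by positivity
  have hkn : 2 ^ k ≤ 2 ^ n := Nat.pow_le_pow_right (by norm_num) h
  have hlt : 2 ^ k - 1 < 2 ^ n := by omega
  refine isMaximalMask_of_deposit fun a ha => ?_
  rw [bitCount_two_pow_add hlt, bitCount_two_pow_sub_one, pow_succ] at ha
  rw [deposit_two_pow_add _ hlt, deposit_two_pow_add _ hlt, bitCount_two_pow_sub_one,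
    deposit_two_pow_sub_one, deposit_two_pow_sub_one]
  obtain ⟨t, ht⟩ := pow_dvd_pow 2 h
  have hdvd : 2 ^ k ∣ 2 ^ n + (2 ^ k - 1) + 1 := ⟨t + 1, by rw [mul_add, ← ht]; omega⟩
  rcases Nat.lt_or_ge (a + 1) (2 ^ k) with h1 | h1
  · rw [Nat.div_eq_of_lt h1, Nat.div_eq_of_lt (show a < 2 ^ k by omega), Nat.mod_eq_of_lt h1,
      Nat.mod_eq_of_lt (show a < 2 ^ k by omega)]
    simp only [Nat.zero_mod, mul_zero, zero_add]
    exact laverMul_neg_one (Nat.succ_pos a) (laverExp_le (Nat.succ_pos a) h1.le) hdvd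
  have hd1 : (a + 1) / 2 ^ k = 1 := Nat.div_eq_of_lt_le (by omega) (by omega)
  have hm1 : (a + 1) % 2 ^ k = a + 1 - 2 ^ k := by
    rw [Nat.mod_eq_sub_mod h1, Nat.mod_eq_of_lt (by omega)]
  rw [hd1, hm1]
  rcases h1.eq_or_lt with h2 | h2
  · rw [show a = 2 ^ k - 1 by omega, Nat.div_eq_of_lt (by omega), Nat.mod_eq_of_lt (by omega)]
    simp only [mul_one, show 2 ^ k - 1 + 1 - 2 ^ k = 0 by omega, add_zero]
    rw [two_pow_laverMul, Nat.add_mod_left, Nat.mod_eq_of_lt hlt]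
    simp
  · have hd2 : a / 2 ^ k = 1 := Nat.div_eq_of_lt_le (by omega) (by omega)
    have hm2 : a % 2 ^ k = a - 2 ^ k := by
      rw [Nat.mod_eq_sub_mod (by omega), Nat.mod_eq_of_lt (by omega)]
    rw [hd2, hm2]
    simp only [Nat.one_mod, mul_one]
    -- The row of `2 ^ n + j`, `0 < j < 2 ^ k`, has a period dividing `2 ^ k`.
    have hexp : laverExp (2 ^ n + (a + 1 - 2 ^ k)) ≤ k := by
      have h3 := laverExp_succ_le_bitCount (2 ^ n + (a - 2 ^ k))
      rw [bitCount_two_pow_add (by omega)] at h3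
      have h4 := bitCount_lt (x := a - 2 ^ k) (a := k) (by omega)
      rw [show 2 ^ n + (a - 2 ^ k) + 1 = 2 ^ n + (a + 1 - 2 ^ k) by omega] at h3
      omega
    rw [laverMul_neg_one (by omega) hexp hdvd]
    omega

/-! ### Elements whose period is not doubled -/

@[simp] theorem deposit_zero_right (x : ℕ) : deposit x 0 = 0 :=
  bitCount_eq_zero (by rw [bitCount_deposit (by positivity), bitCount_zero])

/-- If the leading bit `2 ^ n` doubled the period `2 ^ m` of `x`, then multiplying the identity
`(2 ^ m + b) * c = 2 ^ m` by `2 ^ n + x` would yield `(2 ^ n + x * b) * (x * c) = 2 ^ n`.  This is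
impossible if the period of `2 ^ n + x * b` divides `x * c`. -/
theorem laverExp_two_pow_add_le {n x m A b c : ℕ} (hx : 0 < x) (hxn : x ≤ 2 ^ n)
    (hex : laverExp x ≤ m) (hb : b < 2 ^ m) (hc : c < 2 ^ m) (hbc : (2 ^ m + b) ⋄ c = 2 ^ m)
    (hA : 2 ^ A ∣ x ⋄ c) (hv : laverExp (2 ^ n + x ⋄ b) ≤ A) : laverExp (2 ^ n + x) ≤ m := by
  have hn : 0 < 2 ^ n := by positivity
  have hm : 0 < 2 ^ m := by positivity
  rcases two_pow_add_dichotomy hx hxn with h | ⟨h, hf⟩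
  · omega
  rcases hex.lt_or_eq with hlt | rfl
  · omega
  exfalso
  have h1 := laverMul_distrib (2 ^ n + x) (2 ^ laverExp x + b) c
  rw [hbc, hf, hf (_ + _), hf c, Nat.div_self hm, Nat.add_div_left _ hm, Nat.div_eq_of_lt hb,
    Nat.div_eq_of_lt hc, (laverMul_eq_zero_iff hx).2 dvd_rfl,
    ← laverMul_mod_two_pow hx le_rfl (2 ^ laverExp x + b), Nat.add_mod_left,
    Nat.mod_eq_of_lt hb] at h1
  simp only [Nat.zero_mod, mul_zero, zero_add, Nat.one_mod, mul_one] at h1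
  rw [(laverMul_eq_zero_iff (by omega)).2 ((pow_dvd_pow 2 hv).trans hA)] at h1
  omega

/-- There are residues `b` and `c` modulo `2 ^ m` such that `c`, but not `b`, is divisible by `2 ^ s`
and the leading bit of `2 ^ m + b` shows up in the product `(2 ^ m + b) * c = 2 ^ m`. -/
def HasSplitPair (m s : ℕ) : Prop :=
  ∃ b c, b < 2 ^ m ∧ c < 2 ^ m ∧ ¬ 2 ^ s ∣ b ∧ 2 ^ s ∣ c ∧ (2 ^ m + b) ⋄ c = 2 ^ m

/-- The elements with at most `h` ones above the position `m` whose part below the position `m`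
does not vanish have a period dividing `2 ^ m`. -/
def HasSmallPeriods (m h : ℕ) : Prop :=
  ∀ y x₀, 0 < x₀ → x₀ < 2 ^ m → bitCount y ≤ h → laverExp (2 ^ m * y + x₀) ≤ m

theorem mul_add_sub_one_div {m y x₀ : ℕ} (h0 : 0 < x₀) (hm : x₀ ≤ 2 ^ m) :
    (2 ^ m * y + x₀ - 1) / 2 ^ m = y := by
  rw [show 2 ^ m * y + x₀ - 1 = 2 ^ m * y + (x₀ - 1) by omega,
    Nat.mul_add_div (by positivity), Nat.div_eq_of_lt (by omega), add_zero]

theorem laverExp_lt {m x₀ : ℕ} (h0 : 0 < x₀) (hm : x₀ < 2 ^ m) : laverExp x₀ < m := by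
  have h1 := laverExp_succ_le_bitCount (x₀ - 1)
  rw [Nat.sub_add_cancel h0] at h1
  exact h1.trans_lt (bitCount_lt (by omega))

/-- By induction on the element.  If its leading bit doubled the period, then the period of the
part `x₀` would be `2 ^ s` with `m - h < s < m`, since at most `h - 1` other bits could contribute;
a split pair for `s` reduces this to a smaller element of the same kind. -/
theorem hasSmallPeriods_of_hasSplitPair {m h : ℕ}
    (hK : ∀ s < m, m < s + h → HasSplitPair m s) : HasSmallPeriods m h := by
  suffices H : ∀ p y x₀, p = 2 ^ m * y + x₀ → 0 < x₀ → x₀ < 2 ^ m → bitCount y ≤ h →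
      laverExp (2 ^ m * y + x₀) ≤ m from fun y x₀ => H _ y x₀ rfl
  intro p
  induction p using Nat.strong_induction_on with
  | _ p ih =>
  rintro y x₀ rfl h0 hm hy
  have hM : 0 < 2 ^ m := by positivity
  rcases Nat.eq_zero_or_pos y with rfl | hypos
  · simpa using (laverExp_lt h0 hm).le
  obtain ⟨l, y', hy', rfl⟩ := exists_leading_bit hypos
  rw [bitCount_two_pow_add hy'] at hy
  have e : 2 ^ m * (2 ^ l + y') + x₀ = 2 ^ (m + l) + (2 ^ m * y' + x₀) := by ring
  have hL : 0 < 2 ^ (m + l) := by positivity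
  have hx : 0 < 2 ^ m * y' + x₀ := by omega
  have hxn : 2 ^ m * y' + x₀ ≤ 2 ^ (m + l) := by
    rw [pow_add]; nlinarith
  have hex := ih (2 ^ m * y' + x₀) (by omega) y' x₀ rfl h0 hm (by omega)
  rw [e]
  rcases hex.lt_or_eq with hlt | heq
  · rcases two_pow_add_dichotomy hx hxn with h' | ⟨h', -⟩ <;> omega
  have hs := laverExp_append_le y' h0 hm.le
  obtain ⟨b, c, hb, hc, hsb, hsc, hbc⟩ := hK _ (laverExp_lt h0 hm) (by omega)
  have hmod : ∀ q, ((2 ^ m * y' + x₀) ⋄ q) % 2 ^ m = x₀ ⋄ (q % 2 ^ m) := fun q => by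
    rw [laverMul_mod, Nat.mul_add_mod, Nat.mod_eq_of_lt hm]
  refine laverExp_two_pow_add_le (A := m) hx hxn hex hb hc hbc ?_ ?_
  · refine Nat.dvd_of_mod_eq_zero ?_
    rw [hmod, Nat.mod_eq_of_lt hc, laverMul_eq_zero_iff h0]
    exact hsc
  · have hsub := (laverMul_isSubmask hx b).div m
    rw [mul_add_sub_one_div h0 hm.le] at hsub
    have hw := hmod b
    rw [Nat.mod_eq_of_lt hb] at hw
    have hw0 : 0 < ((2 ^ m * y' + x₀) ⋄ b) % 2 ^ m := by
      rw [hw]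
      exact Nat.pos_of_ne_zero fun h' => hsb ((laverMul_eq_zero_iff h0).1 h')
    have hlt := laverMul_lt b hx
    have hdm := Nat.div_add_mod ((2 ^ m * y' + x₀) ⋄ b) (2 ^ m)
    have hz := hsub.le
    have e2 : 2 ^ (m + l) + (2 ^ m * y' + x₀) ⋄ b =
        2 ^ m * (2 ^ l + (2 ^ m * y' + x₀) ⋄ b / 2 ^ m) + ((2 ^ m * y' + x₀) ⋄ b) % 2 ^ m := by
      rw [mul_add, ← pow_add]; omega
    rw [e2]
    refine ih _ ?_ _ _ rfl hw0 (Nat.mod_lt _ hM) ?_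
    · rw [← e2, e]; omega
    · rw [bitCount_two_pow_add (by omega)]
      have := hsub.bitCount_le
      omega

/-- A row whose index is a multiple of `2 ^ m` acts trivially on the residues modulo `2 ^ m`,
provided its values off the multiples of `2 ^ m` have periods dividing `2 ^ m`. -/
theorem laverMul_add_of_laverExp_le {m P : ℕ} (hP : 0 < P) (hd : 2 ^ m ∣ P)
    (h : ∀ q, q % 2 ^ m ≠ 0 → laverExp (P ⋄ q) ≤ m) (j : ℕ) {w : ℕ} (hw : w < 2 ^ m) :
    P ⋄ (2 ^ m * j + w) = P ⋄ (2 ^ m * j) + w := by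
  induction w with
  | zero => rfl
  | succ w ih =>
    have hq : (2 ^ m * j + (w + 1)) % 2 ^ m ≠ 0 := by
      rw [Nat.mul_add_mod, Nat.mod_eq_of_lt hw]; omega
    have hpos : 0 < P ⋄ (2 ^ m * j + (w + 1)) := by
      refine Nat.pos_of_ne_zero fun h' => hq ?_
      have := laverMul_mod m P (2 ^ m * j + (w + 1))
      rw [h', Nat.mod_eq_zero_of_dvd hd, zero_laverMul, Nat.zero_mod] at this
      exact this.symm
    have h1 := laverMul_rec (2 ^ m * j + w) hP
    rw [add_assoc, laverMul_neg_one hpos (h _ hq) (by rwa [Nat.sub_add_cancel hP]),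
      ih (by omega)] at h1
    omega

/-- Such a row takes the value `P - 2 ^ m` at `-2 ^ m`. -/
theorem laverMul_interval_of_add {m k P : ℕ} (hP : 0 < P) (hPk : P ≤ 2 ^ (m + k))
    (hadd : ∀ j w, w < 2 ^ m → P ⋄ (2 ^ m * j + w) = P ⋄ (2 ^ m * j) + w) :
    P ⋄ (2 ^ m * (2 ^ k - 1)) = P - 2 ^ m := by
  have hm : 0 < 2 ^ m := by positivity
  have hk : 0 < 2 ^ k := by positivity
  have h1 := hadd (2 ^ k - 1) (2 ^ m - 1) (by omega)
  have hd : 2 ^ m * (2 ^ k - 1) + (2 ^ m - 1) + 1 = 2 ^ (m + k) := by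
    rw [pow_add]
    obtain ⟨t, ht⟩ : ∃ t, 2 ^ k = t + 1 := ⟨2 ^ k - 1, by omega⟩
    rw [ht, mul_add]; simp; omega
  rw [laverMul_neg_one (m := m + k) hP (laverExp_le hP hPk) (by rw [hd])] at h1
  omega

theorem HasSmallPeriods.laverMul_add {m h i : ℕ} (hE : HasSmallPeriods m h)
    (hi : bitCount i ≤ h) (j : ℕ) {w : ℕ} (hw : w < 2 ^ m) :
    (2 ^ m * (i + 1)) ⋄ (2 ^ m * j + w) = (2 ^ m * (i + 1)) ⋄ (2 ^ m * j) + w := by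
  have hM : 0 < 2 ^ m := by positivity
  have hP : 0 < 2 ^ m * (i + 1) := by positivity
  refine laverMul_add_of_laverExp_le hP (dvd_mul_right _ _) (fun q hq => ?_) j hw
  have hsub := (laverMul_isSubmask hP q).div m
  rw [mul_add, mul_one, mul_add_sub_one_div hM le_rfl] at hsub
  have hmod := laverMul_mod m (2 ^ m * (i + 1)) q
  rw [Nat.mul_mod_right, zero_laverMul] at hmod
  rw [← Nat.div_add_mod ((2 ^ m * (i + 1)) ⋄ q) (2 ^ m)]
  refine hE _ _ (by omega) (Nat.mod_lt _ hM) ?_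
  rw [mul_add, mul_one]
  exact hsub.bitCount_le.trans hi

/-- A maximal mask `x` above the position `m` may be completed by all the positions below `m`. -/
theorem HasSmallPeriods.isMaximalMask_add_initial {m h x : ℕ} (hE : HasSmallPeriods m h)
    (hx : IsMaximalMask x) (hd : 2 ^ m ∣ x) (hbit : bitCount x ≤ h) :
    IsMaximalMask (x + (2 ^ m - 1)) := by
  obtain ⟨i, rfl⟩ := hd
  have hM : 0 < 2 ^ m := by positivity
  have hb := bitCount_append i (show 2 ^ m - 1 < 2 ^ m by omega)
  rw [bitCount_two_pow_sub_one] at hb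
  rw [bitCount_two_pow_mul] at hbit
  set P := 2 ^ m * (i + 1) with hPdef
  have hP : 0 < P := by positivity
  have hP' : 2 ^ m * i + (2 ^ m - 1) + 1 = P := by rw [hPdef, mul_add]; omega
  have hle := laverExp_succ_le_bitCount (2 ^ m * i + (2 ^ m - 1))
  rw [IsMaximalMask, hb]
  rw [hb, hP'] at hle
  rw [hP']
  have hmk : m ≤ laverExp P := by
    have h1 := laverMul_mod m P (2 ^ laverExp P)
    rw [(laverMul_eq_zero_iff hP).2 dvd_rfl, hPdef, Nat.mul_mod_right, zero_laverMul,
      Nat.zero_mod] at h1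
    exact (Nat.pow_dvd_pow_iff_le_right (by norm_num)).1 (Nat.dvd_of_mod_eq_zero h1.symm)
  obtain ⟨k, hk⟩ := Nat.exists_eq_add_of_le hmk
  -- The element `2 ^ m * i + 1` is the composite of `P` with `g + 1`, where `g` is `-2 ^ m`.
  set g := 2 ^ m * (2 ^ P - 1) with hg
  have hPg : P ⋄ g = 2 ^ m * i := by
    rw [hg, laverMul_interval_of_add hP _ fun j w hw => hE.laverMul_add hbit j hw, hPdef, mul_add]
    · omega
    · exact Nat.lt_two_pow_self.le.trans (Nat.pow_le_pow_right (by norm_num) (by omega))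
  have hcomp : ∀ c, (2 ^ m * i + 1) ⋄ c = P ⋄ ((g + 1) ⋄ c) := fun c => by
    rw [← laverMul_comp hP, hPg]
  have hdvd : ∀ c, 2 ^ m ∣ (g + 1) ⋄ c := by
    intro c
    have h1 := laverMul_mod m (g + 1) c
    rcases Nat.eq_zero_or_pos m with rfl | hm0
    · simp
    have h1m : 1 % 2 ^ m = 1 := Nat.mod_eq_of_lt (Nat.one_lt_two_pow hm0.ne')
    rw [hg, Nat.mul_add_mod, h1m] at h1
    have h2 := laverMul_lt (c % 2 ^ m) one_pos
    exact Nat.dvd_of_mod_eq_zero (by rw [hg]; omega)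
  -- It takes `2 ^ bitCount i` values on multiples of `2 ^ m`, which are distinct modulo the
  -- period of `P`.
  have hcard : 2 ^ bitCount i ≤ 2 ^ k := by
    rw [← Finset.card_range (2 ^ bitCount i), ← Finset.card_range (2 ^ k)]
    refine Finset.card_le_card_of_injOn
      (fun c => ((g + 1) ⋄ c) % 2 ^ laverExp P / 2 ^ m) (fun c _ => ?_) ?_
    · rw [Finset.coe_range, Set.mem_Iio]
      refine Nat.div_lt_of_lt_mul ?_
      rw [← pow_add, ← hk]
      exact Nat.mod_lt _ (by positivity)
    · intro c hc c' hc' hcc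
      rw [Finset.coe_range, Set.mem_Iio] at hc hc'
      have hdm : ∀ c, 2 ^ m ∣ ((g + 1) ⋄ c) % 2 ^ laverExp P := fun c =>
        (Nat.dvd_mod_iff (pow_dvd_pow 2 hmk)).2 (hdvd c)
      have h1 : ((g + 1) ⋄ c) % 2 ^ laverExp P = ((g + 1) ⋄ c') % 2 ^ laverExp P := by
        rw [← Nat.mul_div_cancel' (hdm c), ← Nat.mul_div_cancel' (hdm c')]
        exact congrArg _ hcc
      have h2 := (laverMul_eq_iff hP).2 h1
      rw [← hcomp, ← hcomp, laverMul_eq_iff (Nat.succ_pos _), Nat.succ_eq_add_one, hx,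
        bitCount_two_pow_mul] at h2
      exact Nat.ModEq.eq_of_lt_of_lt h2 hc hc'
  have := (Nat.pow_le_pow_iff_right (by norm_num)).1 hcard
  omega

theorem isMaximalMask_interval {m k : ℕ}
    (h : ∀ a, a + 1 < 2 ^ k → (2 ^ m * (a + 1)) ⋄ (2 ^ m * (2 ^ k - 1)) = 2 ^ m * a) :
    IsMaximalMask (2 ^ m * (2 ^ k - 1)) := by
  refine isMaximalMask_of_deposit fun a ha => ?_
  rw [bitCount_two_pow_mul, bitCount_two_pow_sub_one] at ha
  rw [deposit_two_pow_mul, deposit_two_pow_mul, deposit_two_pow_sub_one, deposit_two_pow_sub_one,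
    Nat.mod_eq_of_lt ha, Nat.mod_eq_of_lt (by omega), h a ha]

theorem bitCount_block (m h : ℕ) : bitCount (2 ^ m * (2 ^ h - 1)) = h := by
  rw [bitCount_two_pow_mul, bitCount_two_pow_sub_one]

theorem block_add (m h : ℕ) : 2 ^ m * (2 ^ h - 1) + 2 ^ m = 2 ^ (m + h) := by
  have : 0 < 2 ^ h := by positivity
  obtain ⟨t, ht⟩ : ∃ t, 2 ^ h = t + 1 := ⟨2 ^ h - 1, by omega⟩
  rw [pow_add, ht]; simp; ring

/-- The masks `[m, m + h) ∪ {n}`. -/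
theorem HasSmallPeriods.isMaximalMask_block {m h n : ℕ} (hE : HasSmallPeriods m h)
    (hn : m + h ≤ n) : IsMaximalMask (2 ^ n + 2 ^ m * (2 ^ h - 1)) := by
  have hM : 0 < 2 ^ m := by positivity
  have hb := block_add m h
  have h1 : IsMaximalMask (2 ^ m * (2 ^ (h + 1) - 1)) := by
    refine isMaximalMask_interval fun a ha => ?_
    have hbit := bitCount_lt ha
    have hle : 2 ^ m * (a + 1) ≤ 2 ^ (m + (h + 1)) := by
      rw [pow_add]; exact Nat.mul_le_mul_left _ ha.le
    rw [laverMul_interval_of_add (by positivity) hle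
      fun j w hw => hE.laverMul_add (by omega) j hw, mul_add]
    omega
  have h2 := isMaximalMask_two_pow_add_initial hn
  have hlt : 2 ^ (m + h) - 1 < 2 ^ n := by
    have : 2 ^ (m + h) ≤ 2 ^ n := Nat.pow_le_pow_right (by norm_num) hn
    have : 0 < 2 ^ (m + h) := by positivity
    omega
  have hsplit : 2 ^ m * (2 ^ (h + 1) - 1) = 2 ^ (m + h) + 2 ^ m * (2 ^ h - 1) := by
    have := block_add m (h + 1)
    rw [← add_assoc, pow_succ 2 (m + h)] at this
    omega
  rw [← h2.deposit_iff] at h1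
  · rw [deposit_two_pow_add _ hlt, deposit_two_pow_sub_one, bitCount_two_pow_sub_one, hsplit,
      Nat.add_div_left _ (by positivity), Nat.div_eq_of_lt (by omega), Nat.add_mod_left,
      Nat.mod_eq_of_lt (show 2 ^ m * (2 ^ h - 1) < 2 ^ (m + h) by omega)] at h1
    simpa using h1
  · rw [bitCount_two_pow_add hlt, bitCount_two_pow_sub_one, hsplit, pow_succ]
    omega

/-- The split pair for `s` is `b = [s, s + f)` together with the position `s - f`, and `c = 2 ^ s`,
where `f` is the lowest bit of `s`: the mask of `2 ^ m + b` is `[0, s - f) ∪ [s, s + f) ∪ {m}`. -/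
theorem hasSplitPair_of_hasSmallPeriods {m d s : ℕ} (hd : 2 ^ d ∣ m)
    (ih : ∀ m' < m, ∀ e, 2 ^ e ∣ m' → HasSmallPeriods m' (2 ^ e)) (hs : s < m)
    (hms : m < s + 2 ^ d) : HasSplitPair m s := by
  have hs0 : s ≠ 0 := by
    rintro rfl
    have := Nat.le_of_dvd hs hd
    omega
  obtain ⟨e, v, hv, rfl⟩ := Nat.exists_eq_two_pow_mul_odd hs0
  obtain ⟨t, rfl⟩ := hv
  set f := 2 ^ e with hf
  have hf0 : 0 < f := by positivity
  have hed : e < d := by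
    by_contra hle
    have h1 : 2 ^ d ∣ f * (2 * t + 1) := (pow_dvd_pow 2 (by omega)).mul_right _
    have h2 := Nat.le_of_dvd (by omega) (Nat.dvd_sub hd h1)
    omega
  have hfm : f ∣ m := (pow_dvd_pow 2 hed.le).trans hd
  have hsf : f * (2 * t + 1) + f ≤ m := by
    have h2 := Nat.le_of_dvd (by omega) (Nat.dvd_sub hfm (dvd_mul_right f (2 * t + 1)))
    omega
  set s := f * (2 * t + 1) with hs'
  have hst : f * (2 * t) + f = s := by rw [hs']; ring
  set m' := f * (2 * t) with hm'
  have hx := (ih s hs e (dvd_mul_right _ _)).isMaximalMask_block hsf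
  have hblock := block_add s f
  have hS : 0 < 2 ^ s := by positivity
  have hM' : 0 < 2 ^ m' := by positivity
  have hpow : 2 ^ (s + f) ≤ 2 ^ m := Nat.pow_le_pow_right (by norm_num) hsf
  have hms' : 2 ^ m' < 2 ^ s := Nat.pow_lt_pow_right (by norm_num) (by omega)
  have hbit := bitCount_two_pow_add (show 2 ^ s * (2 ^ f - 1) < 2 ^ m by omega)
  rw [bitCount_block] at hbit
  have hd' : 2 ^ m' ∣ 2 ^ m + 2 ^ s * (2 ^ f - 1) :=
    (pow_dvd_pow 2 (by omega)).add ((pow_dvd_pow 2 (by omega)).mul_right _)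
  have hy := (ih m' (by omega) (e + 1) ⟨t, by rw [hm', hf]; ring⟩).isMaximalMask_add_initial hx hd'
    (by rw [hbit, pow_succ]; omega)
  have hb' : bitCount (2 ^ s * (2 ^ f - 1) + (2 ^ m' - 1)) = s := by
    rw [bitCount_append _ (show 2 ^ m' - 1 < 2 ^ s by omega), bitCount_two_pow_sub_one,
      bitCount_two_pow_sub_one]
    omega
  have hlt : 2 ^ s * (2 ^ f - 1) + (2 ^ m' - 1) < 2 ^ m := by omega
  refine ⟨2 ^ s * (2 ^ f - 1) + 2 ^ m', 2 ^ s, by omega, ?_, ?_, dvd_rfl, ?_⟩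
  · exact Nat.pow_lt_pow_right (by norm_num) hs
  · rw [Nat.dvd_add_right (dvd_mul_right _ _), Nat.pow_dvd_pow_iff_le_right (by norm_num)]
    omega
  · have h1 := hy.laverMul_eq (2 ^ s)
    rw [add_assoc (2 ^ m), deposit_two_pow_add _ hlt, hb', Nat.div_self hS,
      ← deposit_mod hb'.le, Nat.mod_self, deposit_zero_right] at h1
    rw [show 2 ^ m + (2 ^ s * (2 ^ f - 1) + 2 ^ m') =
      2 ^ m + (2 ^ s * (2 ^ f - 1) + (2 ^ m' - 1)) + 1 by omega, h1]
    simp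

/-- Small periods and split pairs at multiples of powers of two are obtained together, by
induction on the position `m`. -/
theorem hasSmallPeriods {m d : ℕ} (hd : 2 ^ d ∣ m) : HasSmallPeriods m (2 ^ d) := by
  induction m using Nat.strong_induction_on generalizing d with
  | _ m ih =>
    exact hasSmallPeriods_of_hasSplitPair fun s hs hms =>
      hasSplitPair_of_hasSmallPeriods hd (fun m' hm' e he => ih m' hm' he) hs hms

theorem hasSplitPair {m d s : ℕ} (hd : 2 ^ d ∣ m) (hs : s < m) (hms : m < s + 2 ^ d) :
    HasSplitPair m s :=
  hasSplitPair_of_hasSmallPeriods hd (fun _ _ _ he => hasSmallPeriods he) hs hms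

/-! ### Inserting an aligned block -/

/-- A refinement of `HasSmallPeriods` at the position `m`: if the `h` digits above the position
`m` are not all ones, another `h` ones are allowed further up. -/
theorem laverExp_two_blocks_le {m d y₁ z₀ x₀ : ℕ} (hd : 2 ^ d ∣ m) (h0 : 0 < x₀)
    (hm : x₀ < 2 ^ m) (hz : z₀ + 1 < 2 ^ 2 ^ d) (hy : bitCount y₁ ≤ 2 ^ d) :
    laverExp (2 ^ (m + 2 ^ d) * y₁ + (2 ^ m * z₀ + x₀)) ≤ m := by
  have hE := hasSmallPeriods hd
  have hEM : HasSmallPeriods (m + 2 ^ d) (2 ^ d) := hasSmallPeriods (hd.add dvd_rfl)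
  have hK : ∀ s < m, m < s + 2 ^ d → HasSplitPair m s := fun s => hasSplitPair hd
  generalize 2 ^ d = h at *
  suffices H : ∀ p y₁ z₀ x₀, p = 2 ^ (m + h) * y₁ + (2 ^ m * z₀ + x₀) → 0 < x₀ → x₀ < 2 ^ m →
      z₀ + 1 < 2 ^ h → bitCount y₁ ≤ h → laverExp (2 ^ (m + h) * y₁ + (2 ^ m * z₀ + x₀)) ≤ m from
    H _ y₁ z₀ x₀ rfl h0 hm hz hy
  clear h0 hm hz hy y₁ z₀ x₀
  intro p
  induction p using Nat.strong_induction_on with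
  | _ p ih =>
  rintro y₁ z₀ x₀ rfl h0 hm hz hy
  have hM : 0 < 2 ^ m := by positivity
  have hbz : bitCount z₀ < h := bitCount_lt hz
  have hu := hE z₀ x₀ h0 hm hbz.le
  rcases Nat.eq_zero_or_pos y₁ with rfl | hypos
  · simpa using hu
  obtain ⟨l, y', hy', rfl⟩ := exists_leading_bit hypos
  rw [bitCount_two_pow_add hy'] at hy
  obtain ⟨u, hudef⟩ : ∃ u, u = 2 ^ m * z₀ + x₀ := ⟨_, rfl⟩
  have hu0 : 0 < u := by omega
  have huM : u < 2 ^ (m + h) := by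
    rw [hudef, pow_add]; nlinarith
  have e : 2 ^ (m + h) * (2 ^ l + y') + u = 2 ^ (m + h + l) + (2 ^ (m + h) * y' + u) := by ring
  have hL : 0 < 2 ^ (m + h + l) := by positivity
  have hex := ih (2 ^ (m + h) * y' + (2 ^ m * z₀ + x₀)) (by rw [← hudef, e]; omega)
    y' z₀ x₀ rfl h0 hm hz (by omega)
  rw [← hudef] at hu hex ih ⊢
  rw [e] at ih ⊢
  have ex : 2 ^ (m + h) * y' + u = 2 ^ m * (2 ^ h * y' + z₀) + x₀ := by
    rw [hudef, pow_add]; ring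
  obtain ⟨x, hxdef⟩ : ∃ x, x = 2 ^ (m + h) * y' + u := ⟨_, rfl⟩
  have hx : 0 < x := by omega
  have hxn : x ≤ 2 ^ (m + h + l) := by
    rw [hxdef, pow_add _ _ l]; nlinarith
  have hmodM : ∀ q, (x ⋄ q) % 2 ^ (m + h) = u ⋄ (q % 2 ^ (m + h)) := fun q => by
    rw [laverMul_mod, hxdef, Nat.mul_add_mod, Nat.mod_eq_of_lt huM]
  have hmod : ∀ q, (x ⋄ q) % 2 ^ m = x₀ ⋄ (q % 2 ^ m) := fun q => by
    rw [laverMul_mod, hxdef, ex, Nat.mul_add_mod, Nat.mod_eq_of_lt hm]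
  have hmM : 2 ^ m ≤ 2 ^ (m + h) := Nat.pow_le_pow_right (by norm_num) (by omega)
  rw [← hxdef] at hex ih ⊢
  rcases hex.lt_or_eq with hlt | heq
  · rcases two_pow_add_dichotomy hx hxn with h' | ⟨h', -⟩ <;> omega
  rcases hu.lt_or_eq with hum | hum
  · -- The period `2 ^ m` of `x` is reached only by digits above the position `m + h`.
    have ht := laverExp_append_le y' hu0 huM.le
    rw [← hxdef] at ht
    obtain ⟨b, c, hb, hc, hsb, hsc, hbc⟩ := hK _ hum (by omega)
    refine laverExp_two_pow_add_le (A := m + h) hx hxn hex hb hc hbc ?_ ?_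
    · refine Nat.dvd_of_mod_eq_zero ?_
      rw [hmodM, Nat.mod_eq_of_lt (by omega), laverMul_eq_zero_iff hu0]
      exact hsc
    · have hsub := (laverMul_isSubmask hx b).div (m + h)
      rw [hxdef, mul_add_sub_one_div hu0 huM.le, ← hxdef] at hsub
      have hw := hmodM b
      rw [Nat.mod_eq_of_lt (show b < 2 ^ (m + h) by omega)] at hw
      have hdm := Nat.div_add_mod (x ⋄ b) (2 ^ (m + h))
      have hz := hsub.le
      rw [show 2 ^ (m + h + l) + x ⋄ b = 2 ^ (m + h) * (2 ^ l + x ⋄ b / 2 ^ (m + h)) +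
        (x ⋄ b) % 2 ^ (m + h) by rw [mul_add, ← pow_add]; omega]
      refine hEM _ _ ?_ (Nat.mod_lt _ (by positivity)) ?_
      · rw [hw]
        exact Nat.pos_of_ne_zero fun h' => hsb ((laverMul_eq_zero_iff hu0).1 h')
      · rw [bitCount_two_pow_add (by omega)]
        have := hsub.bitCount_le
        omega
  · -- The period `2 ^ m` of `x` is reached already by the digits of `z₀`.
    have hs := laverExp_append_le z₀ h0 hm.le
    rw [← hudef] at hs
    obtain ⟨b, c, hb, hc, hsb, hsc, hbc⟩ := hK _ (laverExp_lt h0 hm) (by omega)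
    refine laverExp_two_pow_add_le (A := m) hx hxn hex hb hc hbc ?_ ?_
    · refine Nat.dvd_of_mod_eq_zero ?_
      rw [hmod, Nat.mod_eq_of_lt hc, laverMul_eq_zero_iff h0]
      exact hsc
    · have hsub := (laverMul_isSubmask hx b).div m
      rw [hxdef, ex, mul_add_sub_one_div h0 hm.le, ← ex, ← hxdef] at hsub
      have hsub1 := hsub.div h
      have hsub0 := hsub.mod h
      rw [Nat.mul_add_div (by positivity), Nat.div_eq_of_lt (show z₀ < 2 ^ h by omega), add_zero,
        Nat.div_div_eq_div_mul, ← pow_add] at hsub1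
      rw [Nat.mul_add_mod, Nat.mod_eq_of_lt (show z₀ < 2 ^ h by omega)] at hsub0
      have hw := hmod b
      rw [Nat.mod_eq_of_lt hb] at hw
      have hw0 : 0 < (x ⋄ b) % 2 ^ m := by
        rw [hw]
        exact Nat.pos_of_ne_zero fun h' => hsb ((laverMul_eq_zero_iff h0).1 h')
      have hlt := laverMul_lt b hx
      have hdm := Nat.div_add_mod (x ⋄ b) (2 ^ (m + h))
      have hdm2 : (x ⋄ b) % 2 ^ (m + h) =
          (x ⋄ b) % 2 ^ m + 2 ^ m * (x ⋄ b / 2 ^ m % 2 ^ h) := by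
        rw [pow_add, Nat.mod_mul]
      have hz1 := hsub1.le
      have hz0 := hsub0.le
      have e2 : 2 ^ (m + h + l) + x ⋄ b = 2 ^ (m + h) * (2 ^ l + x ⋄ b / 2 ^ (m + h)) +
          (2 ^ m * (x ⋄ b / 2 ^ m % 2 ^ h) + (x ⋄ b) % 2 ^ m) := by
        rw [mul_add, ← pow_add]; omega
      have ih' := ih (2 ^ (m + h + l) + x ⋄ b) (by omega) _ _ _ e2 hw0
        (Nat.mod_lt _ hM) (by omega) (by
          rw [bitCount_two_pow_add (by omega)]
          have := hsub1.bitCount_le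
          omega)
      rwa [← e2] at ih'

theorem block_split (m h k : ℕ) :
    2 ^ m * (2 ^ (h + k) - 1) = 2 ^ (m + h) * (2 ^ k - 1) + 2 ^ m * (2 ^ h - 1) := by
  have h1 := block_add m h
  have h2 := block_add (m + h) k
  have h3 := block_add m (h + k)
  rw [← add_assoc] at h3
  omega

theorem block_lt (m h : ℕ) : 2 ^ m * (2 ^ h - 1) < 2 ^ (m + h) := by
  have h1 := block_add m h
  have : 0 < 2 ^ m := by positivity
  omega

/-- The interval `[m, m + 2 * h)` is a maximal mask for every multiple `m` of `h = 2 ^ d`, also if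
`m` is not a multiple of `2 * h`. -/
theorem isMaximalMask_double_interval {m d : ℕ} (hd : 2 ^ d ∣ m) :
    IsMaximalMask (2 ^ m * (2 ^ (2 ^ d + 2 ^ d) - 1)) := by
  have hE2 := fun {y₁ z₀ x₀} => laverExp_two_blocks_le (y₁ := y₁) (z₀ := z₀) (x₀ := x₀) hd
  have hEM : HasSmallPeriods (m + 2 ^ d) (2 ^ d) := hasSmallPeriods (hd.add dvd_rfl)
  generalize 2 ^ d = h at *
  have hM : 0 < 2 ^ m := by positivity
  refine isMaximalMask_interval fun a ha => ?_
  have hP : 0 < 2 ^ m * (a + 1) := by positivity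
  rw [pow_add] at ha
  have hle : 2 ^ m * (a + 1) ≤ 2 ^ (m + (h + h)) := by
    rw [pow_add, pow_add]; exact Nat.mul_le_mul_left _ ha.le
  by_cases hda : 2 ^ h ∣ a + 1
  · obtain ⟨t, ht⟩ := hda
    obtain ⟨a₁, rfl⟩ : ∃ a₁, t = a₁ + 1 :=
      ⟨t - 1, by rcases t with _ | t <;> simp at ht ⊢⟩
    rw [ht] at ha
    have ha1 : a₁ + 1 < 2 ^ h := lt_of_mul_lt_mul_left ha (by positivity)
    have hbit := bitCount_lt ha1
    have e : 2 ^ m * (a + 1) = 2 ^ (m + h) * (a₁ + 1) := by rw [ht, pow_add]; ring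
    have hlt := block_lt m h
    have h1 := laverMul_interval_of_add (k := h) (by positivity) (by
      rw [pow_add _ (m + h)]; exact Nat.mul_le_mul_left _ ha1.le)
      fun j w hw => hEM.laverMul_add hbit.le j hw
    rw [e, block_split, hEM.laverMul_add hbit.le _ hlt, h1, ← e]
    have h2 := block_add m h
    have h3 : 2 ^ (m + h) ≤ 2 ^ m * (a + 1) := by rw [e]; exact Nat.le_mul_of_pos_right _ (by omega)
    rw [mul_add] at h3 ⊢
    omega
  · rw [laverMul_interval_of_add hP hle fun j w hw =>
      laverMul_add_of_laverExp_le hP (dvd_mul_right _ _) (fun q hq => ?_) j hw, mul_add]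
    · omega
    have hsub := (laverMul_isSubmask hP q).div m
    rw [show 2 ^ m * (a + 1) - 1 = 2 ^ m * a + 2 ^ m - 1 by rw [mul_add, mul_one],
      mul_add_sub_one_div hM le_rfl] at hsub
    have hmod := laverMul_mod m (2 ^ m * (a + 1)) q
    rw [Nat.mul_mod_right, zero_laverMul] at hmod
    have hz1 := (hsub.div h).le
    have hz0 := (hsub.mod h).le
    have ha1 : a / 2 ^ h < 2 ^ h := Nat.div_lt_of_lt_mul (by omega)
    have ha0 : a % 2 ^ h + 1 < 2 ^ h := by
      have h1 := Nat.mod_lt a (show 0 < 2 ^ h by positivity)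
      have h2 := Nat.div_add_mod a (2 ^ h)
      by_contra h3
      exact hda ⟨a / 2 ^ h + 1, by rw [mul_add]; omega⟩
    rw [Nat.div_div_eq_div_mul, ← pow_add] at hz1
    have hdm := Nat.div_add_mod ((2 ^ m * (a + 1)) ⋄ q) (2 ^ (m + h))
    have hdm2 : ((2 ^ m * (a + 1)) ⋄ q) % 2 ^ (m + h) =
        ((2 ^ m * (a + 1)) ⋄ q) % 2 ^ m + 2 ^ m * ((2 ^ m * (a + 1)) ⋄ q / 2 ^ m % 2 ^ h) := by
      rw [pow_add, Nat.mod_mul]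
    rw [← hdm, hdm2, add_comm (((2 ^ m * (a + 1)) ⋄ q) % 2 ^ m)]
    exact hE2 (by omega) (Nat.mod_lt _ hM) (by omega) (bitCount_le (by omega))

theorem isMaximalMask_interval_of_le {m d k : ℕ} (hd : 2 ^ d ∣ m) (hk : k ≤ 2 ^ d + 2 ^ d) :
    IsMaximalMask (2 ^ m * (2 ^ k - 1)) := by
  have h1 := (isMaximalMask_double_interval hd).mod (m + k)
  obtain ⟨t, ht⟩ := Nat.exists_eq_add_of_le hk
  rwa [ht, block_split, Nat.mul_add_mod, Nat.mod_eq_of_lt (block_lt m k)] at h1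

/-- Below a maximal mask with at most `h = 2 ^ d` ones one may insert any aligned block of `h`
ones. -/
theorem IsMaximalMask.add_block {m d x : ℕ} (hx : IsMaximalMask x) (hd : 2 ^ d ∣ m)
    (hdx : 2 ^ (m + 2 ^ d) ∣ x) (hbit : bitCount x ≤ 2 ^ d) :
    IsMaximalMask (x + 2 ^ m * (2 ^ 2 ^ d - 1)) := by
  have hF := (hasSmallPeriods (hd.add (dvd_refl (2 ^ d)))).isMaximalMask_add_initial hx hdx hbit
  have hT := isMaximalMask_interval_of_le (k := 2 ^ d + bitCount x) hd (by omega)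
  obtain ⟨i, rfl⟩ := hdx
  rw [bitCount_two_pow_mul] at hT hbit
  generalize 2 ^ d = h at *
  have hlt : 2 ^ (m + h) - 1 < 2 ^ (m + h) := by
    have : 0 < 2 ^ (m + h) := by positivity
    omega
  have hlt2 := block_lt m h
  rw [← hF.deposit_iff] at hT
  · rw [deposit_append _ _ hlt, bitCount_two_pow_sub_one, deposit_two_pow_sub_one, block_split,
      Nat.mul_add_mod, Nat.mul_add_div (by positivity), Nat.div_eq_of_lt hlt2,
      Nat.mod_eq_of_lt hlt2, add_zero, deposit_self] at hT
    exact hT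
  · rw [bitCount_append _ hlt, bitCount_two_pow_sub_one]
    have := block_lt m (h + bitCount i)
    rwa [← add_assoc, add_comm (m + h)] at this

/-! ### The lowest ones of a maximal mask -/

theorem exists_split_bitCount {x k : ℕ} (hk : k ≤ bitCount x) :
    ∃ a x₁ x₀, x₀ < 2 ^ a ∧ x = 2 ^ a * x₁ + x₀ ∧ bitCount x₀ = k := by
  induction x using Nat.strong_induction_on generalizing k with
  | _ x ih =>
    rcases Nat.eq_zero_or_pos k with rfl | hk0
    · exact ⟨0, x, 0, by simp, by simp, bitCount_zero⟩
    have hx : x ≠ 0 := by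
      rintro rfl
      rw [bitCount_zero] at hk
      omega
    have hrec := bitCount_rec x
    obtain ⟨a, x₁, x₀, hlt, hx2, hb⟩ := ih (x / 2) (by omega) (k := k - x % 2) (by omega)
    have e : 2 ^ (a + 1) * x₁ = 2 * (2 ^ a * x₁) := by ring
    refine ⟨a + 1, x₁, 2 * x₀ + x % 2, by rw [pow_succ]; omega, by omega, ?_⟩
    rw [bitCount_rec, show (2 * x₀ + x % 2) / 2 = x₀ by omega, hb]
    omega

theorem two_pow_add_injective {n m x y : ℕ} (hx : x < 2 ^ n) (hy : y < 2 ^ m)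
    (h : 2 ^ n + x = 2 ^ m + y) : n = m ∧ x = y := by
  have h1 : Nat.log 2 (2 ^ n + x) = n := Nat.log_eq_of_pow_le_of_lt_pow (by omega)
    (by rw [pow_succ]; omega)
  have h2 : Nat.log 2 (2 ^ m + y) = m := Nat.log_eq_of_pow_le_of_lt_pow (by omega)
    (by rw [pow_succ]; omega)
  have : n = m := by rw [← h1, ← h2, h]
  subst this
  exact ⟨rfl, by omega⟩

theorem deposit_two_pow_sub_one_right {x k : ℕ} (hk : bitCount x ≤ k) :
    deposit x (2 ^ k - 1) = x := by
  obtain ⟨t, rfl⟩ := Nat.exists_eq_add_of_le hk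
  have h1 : 0 < 2 ^ bitCount x := by positivity
  have h2 := block_split 0 (bitCount x) t
  simp only [pow_zero, one_mul, zero_add] at h2
  rw [h2, ← deposit_mod le_rfl, Nat.mul_add_mod, Nat.mod_eq_of_lt (by omega), deposit_self]

theorem le_of_block_lt_two_pow {u h a : ℕ} (hh : 0 < h) (hlt : 2 ^ u * (2 ^ h - 1) < 2 ^ a) :
    u + h ≤ a := by
  by_contra hc
  obtain ⟨k, rfl⟩ : ∃ k, h = k + 1 := ⟨h - 1, by omega⟩
  have h1 : 2 ^ a ≤ 2 ^ (u + k) := Nat.pow_le_pow_right (by norm_num) (by omega)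
  have h2 : 2 ^ (u + k) ≤ 2 ^ u * (2 ^ (k + 1) - 1) := by
    rw [pow_add, pow_succ]
    exact Nat.mul_le_mul_left _ (by have : 0 < 2 ^ k := by positivity
                                    omega)
  omega

theorem le_of_two_pow_dvd_block {v h a : ℕ} (hh : 0 < h) (hd : 2 ^ a ∣ 2 ^ v * (2 ^ h - 1)) :
    a ≤ v := by
  have hodd : Nat.Coprime (2 ^ a) (2 ^ h - 1) := by
    refine Nat.Coprime.pow_left _ ?_
    rw [Nat.coprime_two_left]
    exact Nat.Even.sub_odd Nat.one_le_two_pow ((Nat.even_pow.2 ⟨even_two, by omega⟩)) odd_one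
  exact (Nat.pow_dvd_pow_iff_le_right (by norm_num)).1 (hodd.dvd_of_dvd_mul_right hd)

/-- An aligned block of `h = 2 ^ d` ones at `v` plus `2 ^ u` acts by the mask `[0, u) ∪ [v, v + h)`. -/
theorem block_add_two_pow_row {d u v : ℕ} (hu : 2 ^ d ∣ u) (hv : 2 ^ d ∣ v) (huv : u ≤ v) :
    laverExp (2 ^ v * (2 ^ 2 ^ d - 1) + 2 ^ u) = u + 2 ^ d ∧
      ∀ q, (2 ^ v * (2 ^ 2 ^ d - 1) + 2 ^ u) ⋄ q =
        2 ^ v * (q / 2 ^ u % 2 ^ 2 ^ d) + q % 2 ^ u := by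
  have hB : IsMaximalMask (2 ^ v * (2 ^ 2 ^ d - 1)) :=
    isMaximalMask_interval_of_le hv (Nat.le_add_left _ _)
  have hm := (hasSmallPeriods hu).isMaximalMask_add_initial hB
    ((pow_dvd_pow 2 huv).mul_right _) (bitCount_block _ _).le
  have hU : 0 < 2 ^ u := by positivity
  have huv2 : 2 ^ u ≤ 2 ^ v := Nat.pow_le_pow_right (by norm_num) huv
  have hlt : 2 ^ u - 1 < 2 ^ v := by omega
  have e : 2 ^ v * (2 ^ 2 ^ d - 1) + (2 ^ u - 1) + 1 = 2 ^ v * (2 ^ 2 ^ d - 1) + 2 ^ u := by omega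
  constructor
  · rw [← e, hm, bitCount_append _ hlt, bitCount_two_pow_sub_one, bitCount_two_pow_sub_one,
      add_comm]
  · intro q
    rw [← e, hm.laverMul_eq, deposit_append _ _ hlt, bitCount_two_pow_sub_one,
      deposit_two_pow_sub_one, deposit_two_pow_sub_one]

/-- For an even multiple `u` of `h`, a leading bit doubles the period. -/
theorem two_pow_add_block_add_two_pow_row {d u v n : ℕ} (hu : 2 ^ (d + 1) ∣ u) (hv : 2 ^ d ∣ v)
    (huv : u ≤ v) (hn : v + 2 ^ d ≤ n) :
    laverExp (2 ^ n + (2 ^ v * (2 ^ 2 ^ d - 1) + 2 ^ u)) =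
      laverExp (2 ^ v * (2 ^ 2 ^ d - 1) + 2 ^ u) + 1 := by
  have hR := (hasSmallPeriods hv).isMaximalMask_block hn
  have hlt := block_lt v (2 ^ d)
  have hvn : 2 ^ (v + 2 ^ d) ≤ 2 ^ n := Nat.pow_le_pow_right (by norm_num) hn
  have hb := bitCount_two_pow_add (hlt.trans_le hvn)
  rw [bitCount_block] at hb
  have h1 : 0 < 2 ^ d := by positivity
  have hm := (hasSmallPeriods hu).isMaximalMask_add_initial hR
    ((pow_dvd_pow 2 (by omega)).add ((pow_dvd_pow 2 huv).mul_right _))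
    (by rw [hb, pow_succ]; omega)
  have hU : 0 < 2 ^ u := by positivity
  have huv2 : 2 ^ u ≤ 2 ^ v := Nat.pow_le_pow_right (by norm_num) huv
  have hba := block_add v (2 ^ d)
  have hlt2 : 2 ^ v * (2 ^ 2 ^ d - 1) + (2 ^ u - 1) < 2 ^ n := by omega
  rw [(block_add_two_pow_row ((pow_dvd_pow 2 (Nat.le_succ d)).trans hu) hv huv).1,
    show 2 ^ n + (2 ^ v * (2 ^ 2 ^ d - 1) + 2 ^ u) =
      2 ^ n + 2 ^ v * (2 ^ 2 ^ d - 1) + (2 ^ u - 1) + 1 by omega, hm, add_assoc (2 ^ n),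
    bitCount_two_pow_add hlt2, bitCount_append _ (by omega), bitCount_two_pow_sub_one,
    bitCount_two_pow_sub_one]
  omega

theorem two_pow_div_mod {a b k : ℕ} (h : a + k ≤ b) : 2 ^ b / 2 ^ a % 2 ^ k = 0 := by
  rw [Nat.pow_div (by omega) (by norm_num)]
  exact Nat.mod_eq_zero_of_dvd (pow_dvd_pow 2 (by omega))

/-- Two aligned blocks of `h` ones at positions `u * h < v * h` admit the product below, which
the element `x + 1` of a maximal mask with these blocks requires, only if they form a single
aligned block of `2 * h` ones. -/
theorem even_and_eq_succ_of_row {d u v n : ℕ} (huv : u < v) (hn : v * 2 ^ d + 2 ^ d ≤ n)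
    (hrow : 2 ^ n ≤ (2 ^ n + (2 ^ (v * 2 ^ d) * (2 ^ 2 ^ d - 1) + 2 ^ (u * 2 ^ d))) ⋄
      (2 ^ (v * 2 ^ d) * (2 ^ 2 ^ d - 1) + 2 ^ (u * 2 ^ d) * (2 ^ 2 ^ d - 1))) :
    Even u ∧ v = u + 1 := by
  have R1 : ∀ s t, s ≤ t →
      laverExp (2 ^ (t * 2 ^ d) * (2 ^ 2 ^ d - 1) + 2 ^ (s * 2 ^ d)) = s * 2 ^ d + 2 ^ d ∧
      ∀ q, (2 ^ (t * 2 ^ d) * (2 ^ 2 ^ d - 1) + 2 ^ (s * 2 ^ d)) ⋄ q =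
        2 ^ (t * 2 ^ d) * (q / 2 ^ (s * 2 ^ d) % 2 ^ 2 ^ d) + q % 2 ^ (s * 2 ^ d) := fun s t hst =>
    block_add_two_pow_row (dvd_mul_left _ _) (dvd_mul_left _ _) (Nat.mul_le_mul_right _ hst)
  have R2 : ∀ s t n, Even s → s ≤ t → t * 2 ^ d + 2 ^ d ≤ n →
      laverExp (2 ^ n + (2 ^ (t * 2 ^ d) * (2 ^ 2 ^ d - 1) + 2 ^ (s * 2 ^ d))) =
        laverExp (2 ^ (t * 2 ^ d) * (2 ^ 2 ^ d - 1) + 2 ^ (s * 2 ^ d)) + 1 :=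
    fun s t n hs hst hn => two_pow_add_block_add_two_pow_row
      (by obtain ⟨r, rfl⟩ := hs; exact ⟨r, by ring⟩) (dvd_mul_left _ _)
      (Nat.mul_le_mul_right _ hst) hn
  have hh : 0 < 2 ^ d := by positivity
  generalize 2 ^ d = h at *
  have hsh : ∀ s t, s < t → s * h + h ≤ t * h := fun s t hst => by
    have := Nat.mul_le_mul_right h hst
    rwa [Nat.succ_mul] at this
  have hP2 : ∀ s t, s ≤ t → 2 ^ s ≤ 2 ^ t := fun s t => Nat.pow_le_pow_right (by norm_num)
  have hpos : ∀ s, 0 < 2 ^ s := fun s => by positivity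
  -- the block `[t * h, t * h + h)` and its bounds
  have hba : ∀ t, 2 ^ (t * h) * (2 ^ h - 1) + 2 ^ (t * h) = 2 ^ (t * h + h) :=
    fun t => block_add (t * h) h
  have hle : ∀ s t, s ≤ t → t * h + h ≤ n →
      2 ^ (t * h) * (2 ^ h - 1) + 2 ^ (s * h) ≤ 2 ^ n := by
    intro s t hst hn
    have h1 := hba t
    have h2 := hP2 _ _ hn
    have h3 := hP2 _ _ (Nat.mul_le_mul_right h hst)
    omega
  have hform : ∀ s t n, s ≤ t → 2 ^ (t * h) * (2 ^ h - 1) + 2 ^ (s * h) ≤ 2 ^ n →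
      laverExp (2 ^ n + (2 ^ (t * h) * (2 ^ h - 1) + 2 ^ (s * h))) =
        laverExp (2 ^ (t * h) * (2 ^ h - 1) + 2 ^ (s * h)) + 1 →
      ∀ q, (2 ^ n + (2 ^ (t * h) * (2 ^ h - 1) + 2 ^ (s * h))) ⋄ q =
        2 ^ n * (q / 2 ^ (s * h + h) % 2) +
          (2 ^ (t * h) * (q / 2 ^ (s * h) % 2 ^ h) + q % 2 ^ (s * h)) := by
    intro s t n hst hle he q
    have hp : 0 < 2 ^ (t * h) * (2 ^ h - 1) + 2 ^ (s * h) := by have := hpos (s * h); omega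
    rcases two_pow_add_dichotomy hp hle with h' | ⟨-, h'⟩
    · omega
    · rw [h', (R1 s t hst).1, (R1 s t hst).2]
  have huv' := hsh u v huv
  have hap : 0 < 2 ^ (v * h) * (2 ^ h - 1) + 2 ^ (u * h) := by have := hpos (u * h); omega
  have hQ : 2 ^ h - 1 < 2 ^ h := by have := hpos h; omega
  have hBu := block_lt (u * h) h
  rcases Nat.even_or_odd u with hu | hu
  · refine ⟨hu, ?_⟩
    by_contra hne
    have huv2 := hsh (u + 1) v (by omega)
    rw [Nat.succ_mul] at huv2
    rw [hform u v n huv.le (hle u v huv.le hn) (R2 u v n hu huv.le hn)] at hrow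
    obtain ⟨k, hk⟩ := Nat.exists_eq_add_of_le huv2
    -- the bit of the right factor at the position `u * h + h` vanishes
    have hbit : (2 ^ (v * h) * (2 ^ h - 1) + 2 ^ (u * h) * (2 ^ h - 1)) / 2 ^ (u * h + h) % 2
        = 0 := by
      rw [hk, show u * h + h + h + k = u * h + h + (h + k) by ring, pow_add _ (u * h + h),
        mul_assoc, Nat.mul_add_div (hpos _), Nat.div_eq_of_lt hBu, add_zero]
      refine Nat.mod_eq_zero_of_dvd (Dvd.dvd.mul_right ?_ _)
      exact dvd_pow_self 2 (by omega)
    have hlt := laverMul_lt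
      (2 ^ (v * h) * (2 ^ h - 1) + 2 ^ (u * h) * (2 ^ h - 1)) hap
    rw [(R1 u v huv.le).2] at hlt
    have := hle u v huv.le hn
    rw [hbit, mul_zero, zero_add] at hrow
    omega
  · exfalso
    obtain ⟨w, hwe, rfl⟩ : ∃ w, Even w ∧ u = w + 1 := by
      obtain ⟨r, rfl⟩ := hu
      exact ⟨2 * r, even_two_mul r, rfl⟩
    have hwu : (w + 1) * h = w * h + h := Nat.succ_mul w h
    have hwv : w < v := by omega
    have huv := huv.le
    -- the row of the element with `w = u - 1` in place of `u`, which is maximal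
    have F2 := hform w v n hwv.le (hle w v hwv.le hn) (R2 w v n hwe hwv.le hn)
    have Fb := (R1 w (w + 1) (by omega)).2
    have Fa := (R1 (w + 1) v huv).2
    have Ea := (R1 (w + 1) v huv).1
    have hale := hle (w + 1) v huv hn
    have hw2 : 2 ^ (w * h) < 2 ^ ((w + 1) * h) := Nat.pow_lt_pow_right (by norm_num) (by omega)
    have hab : (2 ^ (v * h) * (2 ^ h - 1) + 2 ^ ((w + 1) * h)) ⋄
        (2 ^ ((w + 1) * h) * (2 ^ h - 1) + 2 ^ (w * h)) =
        2 ^ (v * h) * (2 ^ h - 1) + 2 ^ (w * h) := by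
      rw [Fa, Nat.mul_add_div (hpos _), Nat.div_eq_of_lt hw2, add_zero, Nat.mod_eq_of_lt hQ,
        Nat.mul_add_mod, Nat.mod_eq_of_lt hw2]
    have hlast : ∀ q, q / 2 ^ ((w + 1) * h) % 2 = 0 →
        (2 ^ n + (2 ^ (v * h) * (2 ^ h - 1) + 2 ^ (w * h))) ⋄ q < 2 ^ n := by
      intro q hq
      have hlt := laverMul_lt q (show 0 < 2 ^ (v * h) * (2 ^ h - 1) + 2 ^ (w * h) by
        have := hpos (w * h); omega)
      rw [(R1 w v hwv.le).2] at hlt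
      rw [F2, ← hwu, hq, mul_zero, zero_add]
      exact hlt.trans_le (hle w v hwv.le hn)
    rcases two_pow_add_dichotomy hap hale with hE | ⟨hE, -⟩
    · -- The leading bit does not double the period.
      have hPp : 0 < 2 ^ n + (2 ^ (v * h) * (2 ^ h - 1) + 2 ^ ((w + 1) * h)) := by omega
      rw [← laverMul_mod_two_pow hPp (hE.trans Ea).le,
        show 2 ^ (v * h) = 2 ^ ((w + 1) * h + h) * 2 ^ (v * h - ((w + 1) * h + h)) by
          rw [← pow_add]; congr 1; omega, mul_assoc _ _ (2 ^ h - 1), Nat.mul_add_mod,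
        Nat.mod_eq_of_lt hBu, ← mul_assoc, ← pow_add,
        show (w + 1) * h + h + (v * h - ((w + 1) * h + h)) = v * h by omega] at hrow
      have hbc : (2 ^ ((w + 1) * h) * (2 ^ h - 1) + 2 ^ (w * h)) ⋄ (2 ^ (w * h) * (2 ^ h - 1)) =
          2 ^ ((w + 1) * h) * (2 ^ h - 1) := by
        rw [Fb, Nat.mul_div_cancel_left _ (hpos _), Nat.mod_eq_of_lt hQ, Nat.mul_mod_right,
          add_zero]
      have hcu := block_lt (w * h) h
      rw [← hwu] at hcu
      have hac : (2 ^ (v * h) * (2 ^ h - 1) + 2 ^ ((w + 1) * h)) ⋄ (2 ^ (w * h) * (2 ^ h - 1)) =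
          2 ^ (w * h) * (2 ^ h - 1) := by
        rw [Fa, Nat.div_eq_of_lt hcu, Nat.mod_eq_of_lt hcu, Nat.zero_mod, mul_zero, zero_add]
      rw [← hbc, laverMul_distrib] at hrow
      have hb := two_pow_add_laverMul_cases hap hale
        (2 ^ ((w + 1) * h) * (2 ^ h - 1) + 2 ^ (w * h))
      have hc := two_pow_add_laverMul_cases hap hale (2 ^ (w * h) * (2 ^ h - 1))
      rw [hab] at hb
      rw [hac] at hc
      rcases hb with hb | hb
      · rw [hb] at hrow
        have h1 := laverMul_lt ((2 ^ n + (2 ^ (v * h) * (2 ^ h - 1) + 2 ^ ((w + 1) * h))) ⋄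
          (2 ^ (w * h) * (2 ^ h - 1))) (show 0 < 2 ^ (v * h) * (2 ^ h - 1) + 2 ^ (w * h) by
          have := hpos (w * h); omega)
        have h2 := hle w v hwv.le hn
        omega
      · rw [hb] at hrow
        refine absurd hrow (not_le.2 (hlast _ ?_))
        rcases hc with hc | hc <;> rw [hc]
        · rw [Nat.div_eq_of_lt hcu]
        · obtain ⟨k, hk⟩ := Nat.exists_eq_add_of_le (show (w + 1) * h + 1 ≤ n by omega)
          rw [hk, add_assoc, pow_add, Nat.mul_add_div (hpos _), Nat.div_eq_of_lt hcu, add_zero]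
          exact Nat.mod_eq_zero_of_dvd (dvd_pow_self 2 (by omega))
    · -- The leading bit doubles the period.
      have FP := hform (w + 1) v n huv hale hE
      have hbE : 2 ^ ((w + 1) * h) * (2 ^ h - 1) + 2 ^ (w * h) < 2 ^ ((w + 1) * h + h) := by
        have := hba (w + 1)
        omega
      have Fbb := hform w (w + 1) ((w + 1) * h + h) (by omega) hbE.le
        (R2 w (w + 1) _ hwe (by omega) le_rfl)
      have hbc : (2 ^ ((w + 1) * h + h) + (2 ^ ((w + 1) * h) * (2 ^ h - 1) + 2 ^ (w * h))) ⋄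
          2 ^ ((w + 1) * h) = 2 ^ ((w + 1) * h + h) := by
        rw [Fbb, ← hwu, Nat.div_self (hpos _), two_pow_div_mod (by omega),
          Nat.mod_eq_zero_of_dvd (pow_dvd_pow 2 (by omega))]
        simp
      have hPb : (2 ^ n + (2 ^ (v * h) * (2 ^ h - 1) + 2 ^ ((w + 1) * h))) ⋄
          (2 ^ ((w + 1) * h + h) + (2 ^ ((w + 1) * h) * (2 ^ h - 1) + 2 ^ (w * h))) =
          2 ^ n + (2 ^ (v * h) * (2 ^ h - 1) + 2 ^ (w * h)) := by
        have hq : 2 ^ ((w + 1) * h + h) + (2 ^ ((w + 1) * h) * (2 ^ h - 1) + 2 ^ (w * h)) =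
            2 ^ ((w + 1) * h) * (2 ^ h + (2 ^ h - 1)) + 2 ^ (w * h) := by rw [pow_add]; ring
        rw [FP, Nat.add_div_left _ (hpos _), Nat.div_eq_of_lt hbE, hq, Nat.mul_add_div (hpos _),
          Nat.div_eq_of_lt hw2, add_zero, Nat.add_mod_left, Nat.mod_eq_of_lt hQ, Nat.mul_add_mod,
          Nat.mod_eq_of_lt hw2]
        simp
      have hPc : (2 ^ n + (2 ^ (v * h) * (2 ^ h - 1) + 2 ^ ((w + 1) * h))) ⋄ 2 ^ ((w + 1) * h) =
          2 ^ (v * h) := by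
        rw [FP, Nat.div_eq_of_lt (Nat.pow_lt_pow_right (by norm_num) (by omega)),
          Nat.div_self (hpos _), Nat.mod_self,
          Nat.mod_eq_of_lt (Nat.one_lt_two_pow (by omega))]
        simp
      have hPE : (2 ^ n + (2 ^ (v * h) * (2 ^ h - 1) + 2 ^ ((w + 1) * h))) ⋄
          2 ^ ((w + 1) * h + h) = 2 ^ n := by
        rw [FP, Nat.div_self (hpos _), two_pow_div_mod le_rfl,
          Nat.mod_eq_zero_of_dvd (pow_dvd_pow 2 (by omega))]
        simp
      have hfin := laverMul_distrib (2 ^ n + (2 ^ (v * h) * (2 ^ h - 1) + 2 ^ ((w + 1) * h)))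
        (2 ^ ((w + 1) * h + h) + (2 ^ ((w + 1) * h) * (2 ^ h - 1) + 2 ^ (w * h)))
        (2 ^ ((w + 1) * h))
      rw [hbc, hPE, hPb, hPc] at hfin
      have := hlast (2 ^ (v * h)) (by simpa using two_pow_div_mod (k := 1) (by omega))
      omega

/-- Below the leading bit of a maximal mask with `h + 1` ones, `h = 2 ^ d`, lies an aligned block
of `h` ones. -/
theorem IsMaximalMask.eq_block {d x : ℕ} (hx : IsMaximalMask x) (hb : bitCount x = 2 ^ d + 1) :
    ∃ u n, u * 2 ^ d + 2 ^ d ≤ n ∧ x = 2 ^ n + 2 ^ (u * 2 ^ d) * (2 ^ 2 ^ d - 1) := by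
  induction d generalizing x with
  | zero =>
    obtain ⟨n, x', hx', rfl⟩ := exists_leading_bit (x := x)
      (Nat.pos_of_ne_zero (by rintro rfl; simp at hb))
    rw [bitCount_two_pow_add hx'] at hb
    obtain ⟨u, x'', hx'', rfl⟩ := exists_leading_bit (x := x')
      (Nat.pos_of_ne_zero (by rintro rfl; simp at hb))
    rw [bitCount_two_pow_add hx''] at hb
    obtain rfl := bitCount_eq_zero (x := x'') (by simpa using hb)
    refine ⟨u, n, ?_, by simp⟩
    have := (Nat.pow_lt_pow_iff_right (a := 2) (by norm_num)).1 (by simpa using hx')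
    simpa using this
  | succ d ih =>
    have hG := (hasSmallPeriods (dvd_refl (2 ^ d))).isMaximalMask_block (n := 2 ^ d + 2 ^ d) le_rfl
    have hrow := fun {u v n} => even_and_eq_succ_of_row (d := d) (u := u) (v := v) (n := n)
    have hh : 0 < 2 ^ d := by positivity
    rw [pow_succ, mul_two] at hb ⊢
    generalize 2 ^ d = h at *
    obtain ⟨n, x', hx', rfl⟩ := exists_leading_bit (x := x)
      (Nat.pos_of_ne_zero (by rintro rfl; simp at hb))
    rw [bitCount_two_pow_add hx'] at hb
    have hb' : bitCount x' = h + h := by omega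
    obtain ⟨a, x₁, x₀, hx0, rfl, hb0⟩ := exists_split_bitCount (x := x') (k := h) (by omega)
    rw [bitCount_append _ hx0, hb0] at hb'
    have hb1 : bitCount x₁ = h := by omega
    have hH : 0 < 2 ^ h := by positivity
    have hH2 : 2 ^ (h + h) = 2 ^ h * 2 ^ h := pow_add 2 h h
    have hdep : ∀ y, deposit (2 ^ n + (2 ^ a * x₁ + x₀)) y =
        2 ^ n * (y / 2 ^ (h + h) % 2) + (2 ^ a * deposit x₁ (y / 2 ^ h) + deposit x₀ y) := by
      intro y
      rw [deposit_two_pow_add _ hx', deposit_append _ _ hx0, bitCount_append _ hx0, hb0, hb1]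
    have hbx : bitCount (2 ^ n + (2 ^ a * x₁ + x₀)) = h + h + 1 := by
      rw [bitCount_two_pow_add hx', bitCount_append _ hx0, hb0, hb1]
    have hQ : 2 ^ h - 1 < 2 ^ h := by omega
    have hblt := block_lt h h
    have hhh : 2 ^ h ≤ 2 ^ (h + h) := Nat.pow_le_pow_right (by norm_num) (by omega)
    -- the lowest `h` ones together with the leading one
    obtain ⟨u, n₁, hn1, he1⟩ : ∃ u n₁, u * h + h ≤ n₁ ∧
        2 ^ n + x₀ = 2 ^ n₁ + 2 ^ (u * h) * (2 ^ h - 1) := by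
      have h1 := isMaximalMask_two_pow_add_initial (show h ≤ h + h by omega)
      have hy : 2 ^ (h + h) + (2 ^ h - 1) < 2 ^ (h + h + 1) := by rw [pow_succ]; omega
      have h2 := (hx.deposit_iff (by rwa [hbx])).2 h1
      have hd : deposit (2 ^ n + (2 ^ a * x₁ + x₀)) (2 ^ (h + h) + (2 ^ h - 1)) = 2 ^ n + x₀ := by
        rw [hdep, Nat.add_div_left _ (by positivity), Nat.div_eq_of_lt (by omega), hH2,
          Nat.mul_add_div hH, Nat.div_eq_of_lt hQ, add_zero, ← deposit_mod hb1.le, Nat.mod_self,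
          ← deposit_mod (x := x₀) hb0.le, Nat.mul_add_mod, Nat.mod_eq_of_lt hQ,
          deposit_two_pow_sub_one_right hb0.le]
        simp
      rw [hd] at h2
      exact ih h2 (by rw [bitCount_two_pow_add (by omega), hb0])
    -- the next `h` ones together with the leading one
    have hd2 : deposit (2 ^ n + (2 ^ a * x₁ + x₀)) (2 ^ (h + h) + 2 ^ h * (2 ^ h - 1)) =
        2 ^ n + 2 ^ a * x₁ := by
      rw [hdep, Nat.add_div_left _ (by positivity), Nat.div_eq_of_lt (by omega), hH2, ← mul_add,
        Nat.mul_div_cancel_left _ hH, ← deposit_mod hb1.le, Nat.add_mod_left, Nat.mod_eq_of_lt hQ,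
        deposit_two_pow_sub_one_right hb1.le, ← deposit_mod (x := x₀) hb0.le, Nat.mul_mod_right]
      simp
    obtain ⟨v, n₂, hn2, he2⟩ : ∃ v n₂, v * h + h ≤ n₂ ∧
        2 ^ n + 2 ^ a * x₁ = 2 ^ n₂ + 2 ^ (v * h) * (2 ^ h - 1) := by
      have hy : 2 ^ (h + h) + 2 ^ h * (2 ^ h - 1) < 2 ^ (h + h + 1) := by rw [pow_succ]; omega
      have h2 := (hx.deposit_iff (by rwa [hbx])).2 hG
      rw [hd2] at h2
      exact ih h2 (by rw [bitCount_two_pow_add (by omega), bitCount_two_pow_mul, hb1])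
    have hle1 : 2 ^ (u * h + h) ≤ 2 ^ n₁ := Nat.pow_le_pow_right (by norm_num) hn1
    have hle2 : 2 ^ (v * h + h) ≤ 2 ^ n₂ := Nat.pow_le_pow_right (by norm_num) hn2
    have hbu := block_lt (u * h) h
    have hbv := block_lt (v * h) h
    obtain ⟨rfl, rfl⟩ := two_pow_add_injective (by omega) (by omega) he1
    obtain ⟨rfl, hx1⟩ := two_pow_add_injective (by omega) (by omega) he2
    have hua := le_of_block_lt_two_pow hh hx0
    have hav := le_of_two_pow_dvd_block hh (hx1 ▸ dvd_mul_right (2 ^ a) x₁)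
    have huv : u < v := by
      by_contra hc
      have := Nat.mul_le_mul_right h (not_lt.1 hc)
      omega
    have h1h : 1 < 2 ^ h := Nat.one_lt_two_pow hh.ne'
    -- multiplication of `y * (2 ^ (2 h) - 1) = y - 1` by `x + 1`, where `y - 1` is the mask
    -- `[h, 2 h) ∪ {2 h}`
    have hmul := laverMul_distrib
      (2 ^ n + (2 ^ a * x₁ + 2 ^ (u * h) * (2 ^ h - 1)) + 1)
      (2 ^ (h + h) + 2 ^ h * (2 ^ h - 1) + 1) (2 ^ (h + h) - 1)
    have hbG : bitCount (2 ^ (h + h) + 2 ^ h * (2 ^ h - 1)) ≤ h + h := by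
      rw [bitCount_two_pow_add hblt, bitCount_block]; omega
    have hd3 : deposit (2 ^ n + (2 ^ a * x₁ + 2 ^ (u * h) * (2 ^ h - 1)))
        (2 ^ (h + h) - 1) = 2 ^ a * x₁ + 2 ^ (u * h) * (2 ^ h - 1) := by
      rw [deposit_two_pow_add _ hx', bitCount_append _ hx0, hb0, hb1,
        Nat.div_eq_of_lt (by omega), deposit_two_pow_sub_one_right]
      · simp
      · rw [bitCount_append _ hx0, hb0, hb1]
    have hd4 : deposit (2 ^ n + (2 ^ a * x₁ + 2 ^ (u * h) * (2 ^ h - 1)))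
        (2 ^ (h + h) + 2 ^ h * (2 ^ h - 1) + 1) = 2 ^ n + (2 ^ a * x₁ + 2 ^ (u * h)) := by
      have hbl := block_add h h
      rw [hdep, deposit_two_pow_mul (u * h), deposit_two_pow_sub_one, add_assoc,
        Nat.add_div_left _ (by positivity), Nat.div_eq_of_lt (by omega), ← add_assoc (2 ^ (h + h)), hH2,
        ← mul_add, Nat.mul_add_div hH, Nat.div_eq_of_lt h1h, Nat.mul_add_mod,
        Nat.mod_eq_of_lt h1h, add_zero, ← deposit_mod hb1.le, Nat.add_mod_left,
        Nat.mod_eq_of_lt hQ, deposit_two_pow_sub_one_right hb1.le]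
      simp
    rw [hG.laverMul_eq, deposit_two_pow_sub_one_right hbG, hx.laverMul_eq, hx.laverMul_eq,
      hx.laverMul_eq, hd2, hd3, hd4, hx1] at hmul
    rw [hx1]
    obtain ⟨⟨r, rfl⟩, rfl⟩ := hrow huv hn2 (hmul ▸ Nat.le_add_right _ _)
    refine ⟨r, n, ?_, ?_⟩
    · rw [Nat.succ_mul] at hn2
      linarith
    · rw [block_split, show r * (h + h) = (r + r) * h by ring, ← Nat.succ_mul]

/-! ### The shape of the maximal masks -/

/-- The values of the words `1 0^{b₀} 1^{2^{a₁}} 0^{b₁ 2^{a₁}} ⋯ 1^{2^{a_r}} 0^{b_r 2^{a_r}}` with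
`a₁ < ⋯ < a_r < d`, the last block of digits being added by `snoc`. -/
inductive IsBlockMask : ℕ → ℕ → Prop
  | top (d n : ℕ) : IsBlockMask d (2 ^ n)
  | snoc {a d x : ℕ} (b : ℕ) (hx : IsBlockMask a x) (had : a < d) :
      IsBlockMask d (2 ^ (b * 2 ^ a) * (2 ^ 2 ^ a * x + (2 ^ 2 ^ a - 1)))

theorem IsBlockMask.mono {d d' x : ℕ} (hx : IsBlockMask d x) (h : d ≤ d') :
    IsBlockMask d' x := by
  cases hx with
  | top => exact .top _ _
  | snoc b hx had => exact .snoc b hx (had.trans_le h)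

theorem two_pow_sub_one_lt (k : ℕ) : 2 ^ k - 1 < 2 ^ k := by
  have : 0 < 2 ^ k := by positivity
  omega

theorem IsBlockMask.isMaximalMask_mul {d x : ℕ} (hx : IsBlockMask d x) :
    bitCount x ≤ 2 ^ d ∧ ∀ c, IsMaximalMask (2 ^ (c * 2 ^ d) * x) := by
  induction hx with
  | top d n =>
    rw [bitCount_two_pow]
    refine ⟨Nat.one_le_two_pow, fun c => ?_⟩
    rw [← pow_add]
    simpa using isMaximalMask_two_pow_add_initial (Nat.zero_le (c * 2 ^ d + n))
  | @snoc a d x b _ had ih =>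
    obtain ⟨hb, hm⟩ := ih
    constructor
    · have : 2 ^ (a + 1) ≤ 2 ^ d := Nat.pow_le_pow_right (by norm_num) had
      rw [pow_succ] at this
      rw [bitCount_two_pow_mul, bitCount_append _ (two_pow_sub_one_lt _),
        bitCount_two_pow_sub_one]
      omega
    · intro c
      obtain ⟨t, ht⟩ := pow_dvd_pow 2 had.le
      have h1 := (hm (c * t + b + 1)).add_block (m := (c * t + b) * 2 ^ a) (dvd_mul_left _ _)
        (by rw [← Nat.succ_mul]; exact dvd_mul_right _ _) (by rwa [bitCount_two_pow_mul])
      convert h1 using 1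
      rw [ht]
      ring

theorem IsBlockMask.of_two_pow_mul {d c x : ℕ} (hx : IsBlockMask d (2 ^ (c * 2 ^ d) * x)) :
    IsBlockMask d x := by
  generalize hz : 2 ^ (c * 2 ^ d) * x = z at hx
  cases hx with
  | top _ n =>
    obtain ⟨k, -, rfl⟩ := (Nat.dvd_prime_pow Nat.prime_two).1 (hz ▸ dvd_mul_left x _)
    exact .top _ _
  | @snoc a _ y b hy had =>
    obtain ⟨t, ht⟩ := pow_dvd_pow 2 had.le
    have hpos : 0 < 2 ^ a := by positivity
    have hodd : Nat.Coprime (2 ^ (c * 2 ^ d)) (2 ^ 2 ^ a * y + (2 ^ 2 ^ a - 1)) := by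
      refine Nat.Coprime.pow_left _ ?_
      rw [Nat.coprime_two_left]
      have he : Even (2 ^ 2 ^ a) := Nat.even_pow.2 ⟨even_two, hpos.ne'⟩
      exact (he.mul_right y).add_odd (Nat.Even.sub_odd Nat.one_le_two_pow he odd_one)
    have hle := (Nat.pow_dvd_pow_iff_le_right (by norm_num)).1
      (hodd.dvd_of_dvd_mul_right (hz ▸ dvd_mul_right _ x))
    rw [ht, mul_left_comm, mul_comm] at hle
    obtain ⟨b', rfl⟩ := Nat.exists_eq_add_of_le (Nat.le_of_mul_le_mul_right hle hpos)
    have : x = 2 ^ (b' * 2 ^ a) * (2 ^ 2 ^ a * y + (2 ^ 2 ^ a - 1)) := by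
      refine Nat.eq_of_mul_eq_mul_left (show 0 < 2 ^ (c * 2 ^ d) by positivity) (hz.trans ?_)
      rw [ht]
      ring
    rw [this]
    exact .snoc b' hy had

theorem exists_two_pow_of_bitCount_eq_one {x : ℕ} (h : bitCount x = 1) : ∃ n, x = 2 ^ n := by
  obtain ⟨n, x', hx', rfl⟩ := exists_leading_bit (x := x)
    (Nat.pos_of_ne_zero (by rintro rfl; simp at h))
  rw [bitCount_two_pow_add hx'] at h
  exact ⟨n, by rw [bitCount_eq_zero (x := x') (by omega), add_zero]⟩

theorem IsMaximalMask.isBlockMask {d x : ℕ} (hx : IsMaximalMask x) (h0 : x ≠ 0)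
    (hb : bitCount x ≤ 2 ^ d) : IsBlockMask d x := by
  induction d generalizing x with
  | zero =>
    have h1 : bitCount x ≠ 0 := fun h => h0 (bitCount_eq_zero h)
    rw [pow_zero] at hb
    obtain ⟨n, rfl⟩ := exists_two_pow_of_bitCount_eq_one (show bitCount x = 1 by omega)
    exact .top _ _
  | succ d ih =>
    rcases Nat.lt_or_ge (2 ^ d) (bitCount x) with hlt | hge
    swap
    · exact (ih hx h0 hge).mono (Nat.le_succ d)
    have hT := fun k => isMaximalMask_interval_of_le (k := k) (dvd_refl (2 ^ d))
    have hB := fun {x} => IsMaximalMask.eq_block (d := d) (x := x)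
    have hcons : ∀ u x, IsBlockMask d x →
        IsBlockMask (d + 1) (2 ^ (u * 2 ^ d) * (2 ^ 2 ^ d * x + (2 ^ 2 ^ d - 1))) :=
      fun u x hx => .snoc u hx (Nat.lt_succ_self d)
    have hof := fun {c x} => IsBlockMask.of_two_pow_mul (d := d) (c := c) (x := x)
    have hh : 0 < 2 ^ d := by positivity
    rw [pow_succ, mul_two] at hb
    generalize 2 ^ d = h at *
    obtain ⟨j, hj⟩ := Nat.exists_eq_add_of_lt hlt
    obtain ⟨a, x₁, x₀, hx0, rfl, hb0⟩ := exists_split_bitCount hlt.le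
    have hbx := bitCount_append x₁ hx0
    have hb1 : bitCount x₁ = j + 1 := by omega
    have hH : 0 < 2 ^ h := by positivity
    have hQ := two_pow_sub_one_lt h
    have hjh : 2 ^ (h + j) = 2 ^ h * 2 ^ j := pow_add 2 h j
    have hjh1 : 2 ^ (h + j + 1) = 2 ^ (h + j) * 2 := pow_succ 2 (h + j)
    have hle : 2 ^ h ≤ 2 ^ (h + j) := Nat.pow_le_pow_right (by norm_num) (by omega)
    -- the lowest `h` ones form an aligned block
    obtain ⟨u, hu⟩ : ∃ u, x₀ = 2 ^ (u * h) * (2 ^ h - 1) := by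
      have h2 := (hx.deposit_iff (y := 2 ^ (h + j) + (2 ^ h - 1)) (by rw [hj]; omega)).2
        (isMaximalMask_two_pow_add_initial (by omega))
      rw [deposit_append _ _ hx0, hb0, hjh, Nat.mul_add_div hH, Nat.div_eq_of_lt hQ, add_zero,
        ← deposit_mod (x := x₀) hb0.le, Nat.mul_add_mod, Nat.mod_eq_of_lt hQ,
        deposit_two_pow_sub_one_right hb0.le] at h2
      have h3 : bitCount (deposit x₁ (2 ^ j)) = 1 := by
        rw [bitCount_deposit (by rw [hb1]; exact Nat.pow_lt_pow_right (by norm_num) (by omega)),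
          bitCount_two_pow]
      obtain ⟨s, hs⟩ := exists_two_pow_of_bitCount_eq_one h3
      have hsa : 2 ^ a ≤ 2 ^ (a + s) := Nat.pow_le_pow_right (by norm_num) (by omega)
      rw [hs, ← pow_add] at h2
      obtain ⟨u, n, hun, he⟩ := hB h2 (by rw [bitCount_two_pow_add (by omega), hb0])
      have h4 := block_lt (u * h) h
      have h5 : 2 ^ (u * h + h) ≤ 2 ^ n := Nat.pow_le_pow_right (by norm_num) hun
      exact ⟨u, (two_pow_add_injective (by omega) (by omega) he).2⟩
    -- the remaining ones form a maximal mask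
    have hrest : IsMaximalMask (2 ^ a * x₁) := by
      have hlt := block_lt h (j + 1)
      have h2 := (hx.deposit_iff (y := 2 ^ h * (2 ^ (j + 1) - 1))
        (by rwa [hj])).2 (hT (j + 1) (by omega))
      rwa [deposit_append _ _ hx0, hb0, Nat.mul_div_cancel_left _ hH, ← hb1, deposit_self,
        ← deposit_mod (x := x₀) hb0.le, Nat.mul_mod_right, deposit_zero_right, add_zero] at h2
    have hx1 : x₁ ≠ 0 := by
      rintro rfl
      rw [bitCount_zero] at hb1
      omega
    have hmask := ih hrest (by positivity) (by rw [bitCount_two_pow_mul]; omega)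
    obtain ⟨a', ha'⟩ := Nat.exists_eq_add_of_le (le_of_block_lt_two_pow hh (hu ▸ hx0))
    have e : 2 ^ a * x₁ = 2 ^ ((u + 1) * h) * (2 ^ a' * x₁) := by
      rw [← mul_assoc, ← pow_add, ha', Nat.succ_mul]
    rw [e] at hmask ⊢
    have := hcons u _ (hof hmask)
    rwa [mul_add, ← mul_assoc, ← pow_add, ← Nat.succ_mul, ← hu] at this

/-! ### Words -/

theorem ofDigits_replicate_zero (n : ℕ) : Nat.ofDigits 2 (List.replicate n 0) = 0 := by
  induction n with
  | zero => simp
  | succ n ih => simp [List.replicate_succ, Nat.ofDigits_cons, ih]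

theorem ofDigits_replicate_one (n : ℕ) : Nat.ofDigits 2 (List.replicate n 1) = 2 ^ n - 1 := by
  induction n with
  | zero => simp
  | succ n ih =>
    have : 0 < 2 ^ n := by positivity
    rw [List.replicate_succ, Nat.ofDigits_cons, ih, pow_succ]
    omega

theorem ofDigits_maximalWord_zero (b₀ : ℕ) (a b : Fin 0 → ℕ) :
    Nat.ofDigits 2 (maximalWord b₀ a b).reverse = 2 ^ b₀ := by
  simp [maximalWord, Nat.ofDigits_append]

theorem ofDigits_maximalWord_succ (b₀ : ℕ) {r : ℕ} (a b : Fin (r + 1) → ℕ) :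
    Nat.ofDigits 2 (maximalWord b₀ a b).reverse =
      2 ^ (b (Fin.last r) * 2 ^ a (Fin.last r)) * (2 ^ 2 ^ a (Fin.last r) *
        Nat.ofDigits 2 (maximalWord b₀ (fun i => a i.castSucc) (fun i => b i.castSucc)).reverse +
        (2 ^ 2 ^ a (Fin.last r) - 1)) := by
  have h : maximalWord b₀ a b =
      maximalWord b₀ (fun i => a i.castSucc) (fun i => b i.castSucc) ++
        (List.replicate (2 ^ a (Fin.last r)) 1 ++
          List.replicate (b (Fin.last r) * 2 ^ a (Fin.last r)) 0) := by
    unfold maximalWord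
    rw [List.ofFn_succ', List.concat_eq_append, List.flatten_append]
    simp
  rw [h, List.reverse_append, List.reverse_append, List.reverse_replicate, List.reverse_replicate,
    Nat.ofDigits_append, Nat.ofDigits_append, ofDigits_replicate_zero, ofDigits_replicate_one]
  simp only [List.length_append, List.length_replicate]
  ring

theorem isBlockMask_iff {d x : ℕ} : IsBlockMask d x ↔ ∃ (b₀ r : ℕ) (a b : Fin r → ℕ),
    StrictMono a ∧ (∀ i, a i < d) ∧ x = Nat.ofDigits 2 (maximalWord b₀ a b).reverse := by
  constructor
  · intro hx
    induction hx with
    | top d n =>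
      exact ⟨n, 0, Fin.elim0, Fin.elim0, fun i => i.elim0, fun i => i.elim0,
        (ofDigits_maximalWord_zero _ _ _).symm⟩
    | @snoc e d x c _ had ih =>
      obtain ⟨b₀, r, a, b, ha, hae, rfl⟩ := ih
      refine ⟨b₀, r + 1, Fin.snoc a e, Fin.snoc b c, ?_, ?_, ?_⟩
      · intro i j hij
        induction i using Fin.lastCases with
        | last => exact absurd hij (Fin.le_last j).not_gt
        | cast i =>
          induction j using Fin.lastCases with
          | last => simpa using hae i
          | cast j => simpa using ha (by simpa using hij)
      · intro i
        induction i using Fin.lastCases with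
        | last => simpa using had
        | cast i => simpa using (hae i).trans had
      · rw [ofDigits_maximalWord_succ]
        simp
  · rintro ⟨b₀, r, a, b, ha, had, rfl⟩
    induction r generalizing d with
    | zero =>
      rw [ofDigits_maximalWord_zero]
      exact .top _ _
    | succ r ih =>
      rw [ofDigits_maximalWord_succ]
      refine .snoc _ (ih _ _ (fun i j hij => ha (by simpa using hij)) fun i => ?_) (had _)
      exact ha (Fin.castSucc_lt_last i)

theorem reverse_digits_eq_maximalWord_iff {x b₀ r : ℕ} (a b : Fin r → ℕ) :
    (Nat.digits 2 x).reverse = maximalWord b₀ a b ↔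
      x = Nat.ofDigits 2 (maximalWord b₀ a b).reverse := by
  constructor
  · intro h
    rw [← h, List.reverse_reverse, Nat.ofDigits_digits]
  · rintro rfl
    rw [Nat.digits_ofDigits 2 (by norm_num), List.reverse_reverse]
    · intro l hl
      simp only [maximalWord, List.mem_reverse, List.mem_cons, List.mem_append,
        List.mem_replicate, List.mem_flatten, List.mem_ofFn] at hl
      rcases hl with rfl | ⟨-, rfl⟩ | ⟨_, ⟨i, rfl⟩, hl⟩
      · norm_num
      · norm_num
      · rw [List.mem_append, List.mem_replicate, List.mem_replicate] at hl
        omega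
    · intro h
      simp [maximalWord]

theorem isMaximalElement_iff {p : ℕ} (hp : 0 < p) :
    IsMaximalElement p ↔ IsMaximalMask (p - 1) := by
  rw [IsMaximalElement, IsMaximalMask, laverPeriod_eq hp, Nat.sub_add_cancel hp]
  exact ⟨fun h => Nat.pow_right_injective le_rfl h.2, fun h => ⟨hp, by rw [h]⟩⟩

theorem mainTheorem2 :
    {p : ℕ | IsMaximalElement p} =
      {1} ∪ {p : ℕ | 2 ≤ p ∧ ∃ (b₀ r : ℕ) (a b : Fin r → ℕ), StrictMono a ∧
        (Nat.digits 2 (p - 1)).reverse = maximalWord b₀ a b} := by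
  ext p
  simp only [Set.mem_ofPred_eq, Set.mem_union, Set.mem_singleton_iff,
    reverse_digits_eq_maximalWord_iff]
  rcases Nat.lt_or_ge p 2 with hp | hp
  · rcases Nat.eq_zero_or_pos p with rfl | h0
    · simp [IsMaximalElement]
    · obtain rfl : p = 1 := by omega
      simpa [isMaximalElement_iff one_pos] using isMaximalMask_zero
  · rw [isMaximalElement_iff (by omega)]
    constructor
    · intro h
      obtain ⟨b₀, r, a, b, ha, -, hx⟩ := isBlockMask_iff.1
        (h.isBlockMask (by omega) (Nat.lt_two_pow_self).le)
      exact Or.inr ⟨hp, b₀, r, a, b, ha, hx⟩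
    · rintro (rfl | ⟨-, b₀, r, a, b, ha, hx⟩)
      · omega
      · -- all the exponents are below `d`
        obtain ⟨d, hd⟩ : ∃ d, ∀ i, a i < d :=
          ⟨∑ i, a i + 1, fun i => Nat.lt_succ_of_le
            (Finset.single_le_sum (fun _ _ => Nat.zero_le _) (Finset.mem_univ i))⟩
        have := (isBlockMask_iff.2 ⟨b₀, r, a, b, ha, hd, hx⟩).isMaximalMask_mul.2 0
        simpa using this
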